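/- All languages are subsets of $\{0,1\}^*$. Let $\mathrm{DP}=\{L_1\setminus L_2 : L_1,L_2\in\mathrm{NP}\}$ and let $\mathrm{coDP}$ be the class of complements of $\mathrm{DP}$ languages. A function $f:\{0,1\}^*\to\{0,1\}^*$ is in $\mathrm{NPSV_t}$ if there is a nondeterministic polynomial-time Turing machine $N$ such that, on each input $x$, at least one computation path of $N(x)$ accepts and outputs $f(x)$, and every accepting path of $N(x)$ outputs $f(x)$. A language $A$ is strong nondeterministic 1-truth-table reducible to a language $B$, $A\le^{\mathcal{SN}}_{1\text{-}tt}B$, if some function in $\mathrm{NPSV_t}$ computes from each $x$ a string $z(x)$ and (the truth table of) a predicate $\alpha_x$ of one Boolean variable such that $x\in A\iff\alpha_x(\chi_B(z(x)))$ for all $x$. Let $\mathrm{R}^{\mathcal{SN}}_{1\text{-}tt}(\mathrm{NP})=\{L : (\exists B\in\mathrm{NP})\,[L\le^{\mathcal{SN}}_{1\text{-}tt}B]\}$. For languages $A,B$ let $M^{A:B}$ denote a deterministic polynomial-time oracle Turing machine $M$ (whose running time is polynomially bounded independently of the oracles) that makes, on each input, at most one query to $A$, followed by at most one query to $B$. Let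 $\mathrm{P}^{\mathcal C:\mathcal D}$ be the class of languages $L(M^{A:B})$ with $A\in\mathcal C$, $B\in\mathcal D$ and such an $M$. Let $\mathrm{P}^{\mathrm{NP}:\{\mathrm{NP}\cap\mathrm{coNP}\}}$ be the class of languages $L(M^{A:B})$, with such an $M$ and with $A,B\in\mathrm{NP}$, for which there is a $C\in\mathrm{NP}$ such that for every string $y$: if for some input $x$ the computation $M^{A:B}(x)$ (in which the query to $A$, if any, is answered correctly) queries "$y\in B$?", then $y\in B\iff y\notin C$. Theorem. $$\mathrm{R}^{\mathcal{SN}}_{1\text{-}tt}(\mathrm{NP})=\mathrm{P}^{\mathrm{NP}:\mathrm{NP}\cap\mathrm{coNP}}\subseteq\mathrm{DP}\cap\mathrm{coDP}\subseteq\mathrm{P}^{\mathrm{NP}:\{\mathrm{NP}\cap\mathrm{coNP}\}}.$$ -/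

import Mathlib

/-- A language over the alphabet `{0, 1}`. -/
abbrev Lang : Type := Set (List Bool)

/-- A class of languages. -/
abbrev LangClass : Type := Set Lang

/-- The cells of a tape hold `0`, `1` or the blank symbol (`none`). Tapes are infinite in both
directions. As machines may have any number of tapes, a larger tape alphabet would add nothing:
a tape over it is a bundle of binary tapes whose heads move together. -/
abbrev BitTape : Type := Turing.Tape (Option Bool)

/-- The word of non-blank symbols in front of the first blank of a half-infinite tape. -/
def blankFreePrefix (l : Turing.ListBlank (Option Bool)) : List Bool :=
  l.liftOn (fun u => (u.takeWhile Option.isSome).reduceOption) (by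
    rintro a b ⟨n, rfl⟩
    have h : (List.replicate n (default : Option Bool)).takeWhile Option.isSome = [] := by
      cases n <;> simp [List.replicate_succ, show (default : Option Bool) = none from rfl]
    induction a with
    | nil => simp [h]
    | cons s t ih => cases s <;> simp_all [List.reduceOption_cons_of_some])

/-- The word on a tape: it begins in the scanned cell and extends to the right up to the first
blank. -/
def BitTape.word (T : BitTape) : List Bool := blankFreePrefix T.right₀

/-- The word `w` on an otherwise blank tape, with the head on the first symbol of `w`. -/
def BitTape.ofWord (w : List Bool) : BitTape := Turing.Tape.mk₁ (w.map some)

/-- Write a symbol in the scanned cell, then move the head by at most one cell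
(`none`: the head stays). -/
def BitTape.act (T : BitTape) : Option Bool × Option Turing.Dir → BitTape
  | (s, none) => T.write s
  | (s, some d) => (T.write s).move d

/-- What a machine with tapes `K`, states `Q` and oracles `ι` does in a given state: halt and
accept, halt and reject, query an oracle and enter the state `yes` or `no` according to the
answer, or carry out one of the moves that are allowed when `r k` is the symbol scanned on tape
`k`: change the state and, on each tape, write a symbol and move the head. -/
inductive Instr (K Q ι : Type) : Type
  | accept : Instr K Q ι
  | reject : Instr K Q ι
  | query (i : ι) (yes no : Q) : Instr K Q ι
  | move (δ : (K → Option Bool) → Set (Q × (K → Option Bool × Option Turing.Dir))) : Instr K Q ι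

/-- A nondeterministic multitape Turing machine with one oracle for each `i : ι`. The input is
given on `inTape`, the output is read on `outTape`, queries to oracle `i` are read on `qTape i`.
A machine without oracles is one with `ι = Empty`. -/
structure Machine (ι : Type) : Type 1 where
  /-- the tapes -/
  K : Type
  /-- the states -/
  Q : Type
  finite_tapes : Finite K
  finite_states : Finite Q
  inTape : K
  outTape : K
  qTape : ι → K
  start : Q
  instr : Q → Instr K Q ι

namespace Machine

variable {ι : Type} (M : Machine ι)

/-- A configuration: the state and the tapes (with their heads). -/
structure Cfg : Type where
  state : M.Q
  tape : M.K → BitTape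

open Classical in
/-- The initial configuration on input `x`: all tapes but the input tape are blank. -/
noncomputable def init (x : List Bool) : M.Cfg where
  state := M.start
  tape k := if k = M.inTape then BitTape.ofWord x else default

/-- One step of the machine with the oracles `O`. -/
inductive Step (O : ι → Lang) : M.Cfg → M.Cfg → Prop
  | yes (c : M.Cfg) (i : ι) (y n : M.Q) (h : M.instr c.state = .query i y n)
      (hw : (c.tape (M.qTape i)).word ∈ O i) : Step O c ⟨y, c.tape⟩
  | no (c : M.Cfg) (i : ι) (y n : M.Q) (h : M.instr c.state = .query i y n)
      (hw : (c.tape (M.qTape i)).word ∉ O i) : Step O c ⟨n, c.tape⟩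
  | move (c : M.Cfg) (δ : (M.K → Option Bool) → Set (M.Q × (M.K → Option Bool × Option Turing.Dir)))
      (q : M.Q) (a : M.K → Option Bool × Option Turing.Dir) (h : M.instr c.state = .move δ)
      (ha : (q, a) ∈ δ (fun k => (c.tape k).head)) :
      Step O c ⟨q, fun k => (c.tape k).act (a k)⟩

/-- `M.Steps O n c d`: some computation path leads from `c` to `d` in exactly `n` steps. -/
inductive Steps (O : ι → Lang) : ℕ → M.Cfg → M.Cfg → Prop
  | refl (c : M.Cfg) : Steps O 0 c c
  | tail {n : ℕ} {c d e : M.Cfg} (h : Steps O n c d) (hs : M.Step O d e) : Steps O (n + 1) c e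

/-- The configuration `c` occurs on some computation path on input `x`. -/
def Occurs (O : ι → Lang) (x : List Bool) (c : M.Cfg) : Prop :=
  ∃ n, M.Steps O n (M.init x) c

/-- In the configuration `c` the machine queries oracle `i`. -/
def Asks (c : M.Cfg) (i : ι) : Prop := ∃ y n, M.instr c.state = .query i y n

/-- Some computation path on input `x` is accepting and outputs `w`. -/
def AcceptsWith (O : ι → Lang) (x w : List Bool) : Prop :=
  ∃ c, M.Occurs O x c ∧ M.instr c.state = .accept ∧ (c.tape M.outTape).word = w

/-- The language of the machine with the oracles `O`. -/
def language (O : ι → Lang) : Lang := {x | ∃ c, M.Occurs O x c ∧ M.instr c.state = .accept}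

/-- All computation paths have polynomially bounded length, with a bound that does not depend on
the oracles. -/
def PolyTime : Prop :=
  ∃ p : Polynomial ℕ, ∀ (O : ι → Lang) (x : List Bool) (n : ℕ) (c : M.Cfg),
    M.Steps O n (M.init x) c → n ≤ p.eval x.length

/-- At most one move is possible in each situation. -/
def Deterministic : Prop := ∀ q δ, M.instr q = .move δ → ∀ r, (δ r).Subsingleton

/-- On every input, a query to oracle `i` is followed only by queries to oracles `j > i`. For two
oracles this says: at most one query to oracle `0`, followed by at most one query to
oracle `1`. -/
def OrderedQueries [LT ι] (O : ι → Lang) : Prop :=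
  ∀ (x : List Bool) (c d : M.Cfg) (n : ℕ) (i j : ι), M.Occurs O x c → M.Asks c i →
    M.Steps O (n + 1) c d → M.Asks d j → i < j

end Machine

/-- The oracle family of a machine without oracles. -/
def noOracle : Empty → Lang := fun i => i.elim

/-- NP: the languages of nondeterministic polynomial-time Turing machines. -/
def NP : LangClass := {L | ∃ N : Machine Empty, N.PolyTime ∧ L = N.language noOracle}

/-- The class of the complements of the languages in `C`. -/
def co (C : LangClass) : LangClass := {L | Lᶜ ∈ C}

/-- DP: the differences of two NP languages. -/
def DP : LangClass := {L | ∃ A ∈ NP, ∃ B ∈ NP, L = A \ B}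

/-- The class NPSV_t of functions `f` for which some nondeterministic polynomial-time Turing
machine has, on each input `x`, an accepting path that outputs `f x` and no accepting path with
another output. -/
def NPSVt : Set (List Bool → List Bool) :=
  {f | ∃ N : Machine Empty, N.PolyTime ∧
    ∀ x, N.AcceptsWith noOracle x (f x) ∧ ∀ w, N.AcceptsWith noOracle x w → w = f x}

open Classical in
/-- `A` is strong nondeterministic 1-truth-table reducible to `B`: some function in NPSV_t
computes from `x` a query `z x` and a predicate `α x` of one Boolean variable (given by its truth
table) such that `x ∈ A` if and only if `α x` holds at the value at `z x` of the characteristic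
function of `B`. -/
def SNReducible (A B : Lang) : Prop :=
  ∃ (z : List Bool → List Bool) (α : List Bool → Bool → Bool),
    (fun x => α x false :: α x true :: z x) ∈ NPSVt ∧
    ∀ x, x ∈ A ↔ α x (decide (z x ∈ B)) = true

/-- The closure of `C` downwards under strong nondeterministic 1-truth-table reductions. -/
def RSN (C : LangClass) : LangClass := {L | ∃ B ∈ C, SNReducible L B}

/-- `M` with the oracles `A` and `B` is a deterministic polynomial-time machine that accepts `L`
and makes at most one query to `A` followed by at most one query to `B`. -/
def DecidesWith (M : Machine (Fin 2)) (A B L : Lang) : Prop :=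
  M.Deterministic ∧ M.PolyTime ∧ M.OrderedQueries ![A, B] ∧ L = M.language ![A, B]

/-- The class `P^{C:D}`. -/
def POrdered (C D : LangClass) : LangClass :=
  {L | ∃ A ∈ C, ∃ B ∈ D, ∃ M : Machine (Fin 2), DecidesWith M A B L}

/-- The class `P^{NP:{NP ∩ coNP}}`: on the strings that `M` really asks to the second oracle `B`
(the query to `A` being answered correctly), `B` is complementary to an NP language `C`. -/
def PGuarded : LangClass :=
  {L | ∃ A ∈ NP, ∃ B ∈ NP, ∃ M : Machine (Fin 2), DecidesWith M A B L ∧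
    ∃ C ∈ NP, ∀ y : List Bool,
      (∃ x c, M.Occurs ![A, B] x c ∧ M.Asks c 1 ∧ (c.tape (M.qTape 1)).word = y) →
        (y ∈ B ↔ y ∉ C)}

/-! Let `z`, `α` be a reduction of `L` to an NP set `B`. Ask the first oracle about `x` whether `z x
∈ B`; this is an NP question, since an NP machine can compute `z x`. Then ask the second oracle
about the pair of the answer `b` and `x` whether `α x b` holds. The table is a total single-valued
function, so both outcomes of the second question have NP witnesses, and it lies in NP ∩ coNP
(`RSN_subset_POrdered`).

Conversely, given a machine with ordered queries, `z x` is its first query, which depends on no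
answer, and `α x a` is its verdict when the first answer is `a`. To find this verdict, the answer to
the second query is guessed and verified by the NP machine for `B` or for its complement; exactly
one guess can be verified, so the value is unique (`POrdered_subset_RSN`).

A reducible `L` is the difference of `{α x 0 ∨ (α x 1 ∧ z x ∈ B)}` and `{¬ α x 1 ∧ z x ∈ B}`;
negating `α` treats the complement (`RSN_subset_DP`, `compl_mem_RSN`). If `L = L₁ \ L₂` and `Lᶜ = L₃
\ L₄`, the answer to "`x ∈ L₁ ∩ L₃`?" tells which NP sets decide `L` and `Lᶜ` at `x`: `L₄` and `L₂`
if yes, `L₁` and `L₃` if no (`DP_inter_co_DP_subset_PGuarded`).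

The machine work is confined to `NPMV`, the relations computed by nondeterministic polynomial-time
programs, and its closure under `comp` and `branch`. By `mem_NP_iff` and `mem_NPSVt_iff` it captures
NP and NPSV_t. `Prog.ofOracle` turns an oracle machine with preset answers into such a program. The
only oracle machine written out is `twoQuery`. -/

/-! ### Paths of a step relation. -/

/-- `StepChain r n a b`: a chain of exactly `n` steps of `r` leads from `a` to `b`. -/
inductive StepChain {α : Type*} (r : α → α → Prop) : ℕ → α → α → Prop
  | refl (a : α) : StepChain r 0 a a
  | tail {n : ℕ} {a b c : α} (h : StepChain r n a b) (hs : r b c) : StepChain r (n + 1) a c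

namespace StepChain

variable {α β : Type*} {r : α → α → Prop} {s : β → β → Prop}

theorem trans {m n : ℕ} {a b c : α} (h : StepChain r m a b) (h' : StepChain r n b c) :
    StepChain r (m + n) a c := by
  induction h' with
  | refl => exact h
  | tail _ hs ih => exact (ih h).tail hs

theorem head {n : ℕ} {a b c : α} (hs : r a b) (h : StepChain r n b c) : StepChain r (n + 1) a c := by
  rw [Nat.add_comm]
  exact ((StepChain.refl a).tail hs).trans h

theorem map {n : ℕ} {a b : α} (f : α → β) (hf : ∀ a b, r a b → s (f a) (f b))
    (h : StepChain r n a b) : StepChain s n (f a) (f b) := by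
  induction h with
  | refl => exact .refl _
  | tail _ hs ih => exact ih.tail (hf _ _ hs)

theorem cases_head {n : ℕ} {a c : α} (h : StepChain r n a c) :
    (n = 0 ∧ a = c) ∨ ∃ m b, n = m + 1 ∧ r a b ∧ StepChain r m b c := by
  induction h with
  | refl => exact .inl ⟨rfl, rfl⟩
  | @tail n a b c h hs ih =>
    rcases ih with ⟨rfl, rfl⟩ | ⟨m, d, rfl, hd, hp⟩
    · exact .inr ⟨0, _, rfl, hs, .refl _⟩
    · exact .inr ⟨m + 1, d, rfl, hd, hp.tail hs⟩

/-- If all paths from `a` have length at most `T`, some path ends in a point without successor. -/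
theorem exists_terminal {a : α} {T : ℕ} (h : ∀ n b, StepChain r n a b → n ≤ T) :
    ∃ n b, StepChain r n a b ∧ ∀ c, ¬ r b c := by
  by_contra! hc
  have : ∀ n, ∃ b, StepChain r n a b := by
    intro n
    induction n with
    | zero => exact ⟨a, .refl a⟩
    | succ n ih =>
      obtain ⟨b, hb⟩ := ih
      obtain ⟨c, hr⟩ := hc n b hb
      exact ⟨c, hb.tail hr⟩
  obtain ⟨b, hb⟩ := this (T + 1)
  have := h _ _ hb
  omega

/-- For a deterministic relation, two paths to points without successors end in the same point. -/
theorem terminal_unique {m n : ℕ} {a b c : α} (hr : ∀ a b c, r a b → r a c → b = c)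
    (hm : StepChain r m a b) (hn : StepChain r n a c) (hb : ∀ d, ¬ r b d) (hc : ∀ d, ¬ r c d) :
    b = c := by
  induction m generalizing n a with
  | zero =>
    cases hm
    rcases hn.cases_head with ⟨-, rfl⟩ | ⟨_, _, -, h, -⟩
    · rfl
    · exact absurd h (hb _)
  | succ m ih =>
    rcases hm.cases_head with ⟨h, -⟩ | ⟨m', d, h, hd, hp⟩
    · omega
    obtain rfl : m = m' := by omega
    rcases hn.cases_head with ⟨-, rfl⟩ | ⟨_, d', -, hd', hp'⟩
    · exact absurd hd (hc _)
    · obtain rfl := hr _ _ _ hd hd'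
      exact ih hp hp'

end StepChain

/-! ### Multitape programs with labelled exits, and operations on them. -/

/-- What to do on one tape: write a symbol and move the head. -/
abbrev TapeAct : Type := Option Bool × Option Turing.Dir

/-- The contents of a family of tapes. -/
abbrev Tapes (K : Type) : Type := K → BitTape

namespace Tapes

variable {K : Type}

/-- The scanned symbols. -/
def heads (t : Tapes K) : K → Option Bool := fun k => (t k).head

/-- Act on all tapes. -/
def act (t : Tapes K) (a : K → TapeAct) : Tapes K := fun k => (t k).act (a k)

/-- The actions that change nothing when `r` is scanned. -/
def idle (r : K → Option Bool) : K → TapeAct := fun k => (r k, none)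

theorem _root_.BitTape.act_idle (T : BitTape) : T.act (T.head, none) = T :=
  Turing.Tape.write_self T

@[simp] theorem act_idle (t : Tapes K) : t.act (idle t.heads) = t :=
  funext fun k => (t k).act_idle

open Classical in
/-- The word `x` on tape `i`, all other tapes being blank. -/
noncomputable def input (i : K) (x : List Bool) : Tapes K :=
  fun k => if k = i then BitTape.ofWord x else default

end Tapes

/-- A nondeterministic multitape program with exits labelled by `E`. -/
structure Prog (K E : Type) : Type 1 where
  /-- the states -/
  Q : Type
  finite_states : Finite Q
  start : Q
  /-- what to do in a state: exit or move -/
  code : Q → E ⊕ ((K → Option Bool) → Set (Q × (K → TapeAct)))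

namespace Prog

variable {K K' E F : Type}

/-- One step of a program. -/
def Step (P : Prog K E) (c d : P.Q × Tapes K) : Prop :=
  ∃ δ a, P.code c.1 = .inr δ ∧ (d.1, a) ∈ δ c.2.heads ∧ d.2 = c.2.act a

/-- All paths that start with the tapes `t` have length at most `T`. -/
def Bounded (P : Prog K E) (t : Tapes K) (T : ℕ) : Prop :=
  ∀ n c, StepChain P.Step n (P.start, t) c → n ≤ T

/-- Started with the tapes `t`, the program can reach exit `e` with the tapes `t'`. -/
def Exits (P : Prog K E) (t : Tapes K) (e : E) (t' : Tapes K) : Prop :=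
  ∃ n q, StepChain P.Step n (P.start, t) (q, t') ∧ P.code q = .inl e

/-- Started with the tapes `t`, the program runs for at most `T` steps, and `X` describes the
reachable exits. -/
def Spec (P : Prog K E) (t : Tapes K) (T : ℕ) (X : E → Tapes K → Prop) : Prop :=
  P.Bounded t T ∧ ∀ e t', P.Exits t e t' ↔ X e t'

theorem Spec.mono {P : Prog K E} {t : Tapes K} {T T' : ℕ} {X X' : E → Tapes K → Prop}
    (h : P.Spec t T X) (hT : T ≤ T') (hX : ∀ e t', X e t' ↔ X' e t') : P.Spec t T' X' :=
  ⟨fun n c hp => (h.1 n c hp).trans hT, fun e t' => (h.2 e t').trans (hX e t')⟩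

theorem Bounded.spec {P : Prog K E} {t : Tapes K} {T : ℕ} (h : P.Bounded t T) :
    P.Spec t T (P.Exits t) := ⟨h, fun _ _ => Iff.rfl⟩

/-! ### Atomic loops -/

/-- Repeat an atomic action (`none`) until some action leads to an exit (`some e`). -/
def iter [Finite E] (f : (K → Option Bool) → Set (Option E × (K → TapeAct))) : Prog K E where
  Q := Option E
  finite_states := inferInstance
  start := none
  code
    | none => .inr f
    | some e => .inl e

section iter

variable [Finite E] {f : (K → Option Bool) → Set (Option E × (K → TapeAct))}

theorem iter_step_none {t : Tapes K} {c : Option E × Tapes K} :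
    (iter f).Step (none, t) c ↔ ∃ a, (c.1, a) ∈ f t.heads ∧ c.2 = t.act a := by
  constructor
  · rintro ⟨δ, a, hδ, ha, ht⟩
    cases hδ
    exact ⟨a, ha, ht⟩
  · rintro ⟨a, ha, ht⟩
    exact ⟨f, a, rfl, ha, ht⟩

theorem iter_step_some {e : E} {t : Tapes K} {c : Option E × Tapes K} :
    ¬ (iter f).Step (some e, t) c := by
  rintro ⟨δ, a, hδ, -⟩
  cases hδ

/-- The recursion equation of a loop: an exit is taken in the present round or in the loop restarted
on the changed tapes. Specifications of loops follow from it by induction on the tape contents. -/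
theorem iter_spec {t : Tapes K} {T : ℕ} {X : (K → TapeAct) → E → Tapes K → Prop}
    (h : ∀ a, (none, a) ∈ f t.heads → (iter f).Spec (t.act a) T (X a)) :
    (iter f).Spec t (T + 1) fun e t' =>
      (∃ a, (some e, a) ∈ f t.heads ∧ t' = t.act a) ∨
        ∃ a, (none, a) ∈ f t.heads ∧ X a e t' := by
  constructor
  · intro n c hp
    rcases hp.cases_head with ⟨rfl, -⟩ | ⟨m, ⟨q, t'⟩, rfl, hs, hp⟩
    · omega
    obtain ⟨a, ha, rfl⟩ := iter_step_none.1 hs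
    cases q with
    | none => exact Nat.succ_le_succ ((h a ha).1 m c hp)
    | some e =>
      rcases hp.cases_head with ⟨rfl, -⟩ | ⟨_, _, -, hs, -⟩
      · omega
      · exact (iter_step_some hs).elim
  · intro e t'
    constructor
    · rintro ⟨n, q, hp, hq⟩
      rcases hp.cases_head with ⟨rfl, hc⟩ | ⟨m, ⟨q', t''⟩, rfl, hs, hp⟩
      · cases hc
        cases hq
      obtain ⟨a, ha, rfl⟩ := iter_step_none.1 hs
      cases q' with
      | none => exact .inr ⟨a, ha, ((h a ha).2 e t').1 ⟨m, q, hp, hq⟩⟩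
      | some e' =>
        rcases hp.cases_head with ⟨rfl, hc⟩ | ⟨_, _, -, hs, -⟩
        · cases hc
          cases hq
          exact .inl ⟨a, ha, rfl⟩
        · exact (iter_step_some hs).elim
    · rintro (⟨a, ha, rfl⟩ | ⟨a, ha, hX⟩)
      · exact ⟨1, some e, (StepChain.refl _).tail (iter_step_none.2 ⟨a, ha, rfl⟩), rfl⟩
      · obtain ⟨n, q, hp, hq⟩ := ((h a ha).2 e t').2 hX
        exact ⟨n + 1, q, hp.head (iter_step_none.2 ⟨a, ha, rfl⟩), hq⟩

theorem iter_spec_exit {t : Tapes K} {e : E} {a : K → TapeAct} (h : f t.heads = {(some e, a)}) :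
    (iter f).Spec t 1 fun e' t' => e' = e ∧ t' = t.act a := by
  have := iter_spec (f := f) (t := t) (T := 0) (X := fun _ _ _ => False) (by simp [h])
  refine this.mono le_rfl fun e' t' => ?_
  simp [h, and_assoc]

theorem iter_spec_loop {t : Tapes K} {T : ℕ} {a : K → TapeAct} {X : E → Tapes K → Prop}
    (h : f t.heads = {(none, a)}) (hX : (iter f).Spec (t.act a) T X) :
    (iter f).Spec t (T + 1) X := by
  have := iter_spec (f := f) (t := t) (T := T) (X := fun _ => X) (by
    rw [h]
    rintro b hb
    cases hb
    exact hX)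
  refine this.mono le_rfl fun e' t' => ?_
  simp [h]

end iter

/-! ### Sequential composition -/

/-- Run `P`, and then the program that belongs to the exit of `P`. -/
def bind [Finite E] (P : Prog K E) (R : E → Prog K F) : Prog K F where
  Q := P.Q ⊕ Σ e, (R e).Q
  finite_states := by
    have := P.finite_states
    have := fun e => (R e).finite_states
    infer_instance
  start := .inl P.start
  code
    | .inl q =>
      match P.code q with
      | .inl e => .inr fun r => {(.inr ⟨e, (R e).start⟩, Tapes.idle r)}
      | .inr δ => .inr fun r => {p | ∃ q', p.1 = .inl q' ∧ (q', p.2) ∈ δ r}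
    | .inr ⟨e, q⟩ =>
      match (R e).code q with
      | .inl f => .inl f
      | .inr δ => .inr fun r => {p | ∃ q', p.1 = .inr ⟨e, q'⟩ ∧ (q', p.2) ∈ δ r}

section bind

variable [Finite E] {P : Prog K E} {R : E → Prog K F}

theorem bind_step_inl {q : P.Q} {t : Tapes K} {c : (P.bind R).Q × Tapes K} :
    (P.bind R).Step (.inl q, t) c ↔
      (∃ q' t', c = (.inl q', t') ∧ P.Step (q, t) (q', t')) ∨
        ∃ e, P.code q = .inl e ∧ c = (.inr ⟨e, (R e).start⟩, t) := by
  obtain ⟨q', t'⟩ := c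
  simp only [Step, bind]
  cases h : P.code q with
  | inl e =>
    constructor
    · rintro ⟨_, _, hδ, ha, rfl⟩
      cases hδ
      cases ha
      exact .inr ⟨e, rfl, by simp⟩
    · rintro (⟨_, _, _, _, _, hδ, -⟩ | ⟨_, he, hc⟩)
      · cases hδ
      · cases he
        cases hc
        exact ⟨_, _, rfl, rfl, by simp⟩
  | inr δ =>
    constructor
    · rintro ⟨_, a, hδ, ha, rfl⟩
      cases hδ
      obtain ⟨q'', rfl, ha⟩ := ha
      exact .inl ⟨_, _, rfl, _, _, rfl, ha, rfl⟩
    · rintro (⟨q'', t', hc, _, a, hδ, ha, rfl⟩ | ⟨_, he, -⟩)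
      · cases hδ
        cases hc
        exact ⟨_, a, rfl, ⟨_, rfl, ha⟩, rfl⟩
      · cases he

theorem bind_step_inr {e : E} {q : (R e).Q} {t : Tapes K} {c : (P.bind R).Q × Tapes K} :
    (P.bind R).Step (.inr ⟨e, q⟩, t) c ↔
      ∃ q' t', c = (.inr ⟨e, q'⟩, t') ∧ (R e).Step (q, t) (q', t') := by
  obtain ⟨q', t'⟩ := c
  simp only [Step, bind]
  cases h : (R e).code q with
  | inl f => simp
  | inr δ =>
    constructor
    · rintro ⟨_, a, hδ, ha, rfl⟩
      cases hδ
      obtain ⟨q'', rfl, ha⟩ := ha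
      exact ⟨_, _, rfl, _, _, rfl, ha, rfl⟩
    · rintro ⟨q'', t', hc, _, a, hδ, ha, rfl⟩
      cases hδ
      cases hc
      exact ⟨_, a, rfl, ⟨_, rfl, ha⟩, rfl⟩

/-- The states of `P` are left only by the handover step at an exit of `P`, and there is no way
back, so a path contains at most one such step. -/
theorem bind_path {n : ℕ} {t : Tapes K} {c : (P.bind R).Q × Tapes K}
    (h : StepChain (P.bind R).Step n ((P.bind R).start, t) c) :
    (∃ q t', c = (.inl q, t') ∧ StepChain P.Step n (P.start, t) (q, t')) ∨
      ∃ n₁ n₂ e q₁ t₁ q t', n = n₁ + 1 + n₂ ∧ StepChain P.Step n₁ (P.start, t) (q₁, t₁) ∧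
        P.code q₁ = .inl e ∧ StepChain (R e).Step n₂ ((R e).start, t₁) (q, t') ∧
        c = (.inr ⟨e, q⟩, t') := by
  generalize hc : ((P.bind R).start, t) = c₀ at h
  induction h with
  | refl => exact .inl ⟨P.start, t, hc.symm, .refl _⟩
  | tail _ hs ih =>
    rcases ih hc with ⟨q, t', rfl, hp⟩ | ⟨n₁, n₂, e, q₁, t₁, q, t', rfl, h₁, hq₁, h₂, rfl⟩
    · rcases bind_step_inl.1 hs with ⟨q', t'', rfl, hs'⟩ | ⟨e, he, rfl⟩
      · exact .inl ⟨q', t'', rfl, hp.tail hs'⟩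
      · exact .inr ⟨_, 0, e, q, t', _, _, rfl, hp, he, .refl _, rfl⟩
    · obtain ⟨q', t'', rfl, hs'⟩ := bind_step_inr.1 hs
      exact .inr ⟨n₁, n₂ + 1, e, q₁, t₁, q', t'', rfl, h₁, hq₁, h₂.tail hs', rfl⟩

/-- The `1` in the bound is the handover step, which changes no tape. -/
theorem Spec.bind {t : Tapes K} {T₁ T₂ : ℕ} {X : E → Tapes K → Prop}
    {Y : E → Tapes K → F → Tapes K → Prop} (hP : P.Spec t T₁ X)
    (hR : ∀ e t', X e t' → (R e).Spec t' T₂ (Y e t')) :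
    (P.bind R).Spec t (T₁ + 1 + T₂) fun f t'' => ∃ e t', X e t' ∧ Y e t' f t'' := by
  constructor
  · intro n c hp
    rcases bind_path hp with ⟨q, t', rfl, hp'⟩ | ⟨n₁, n₂, e, q₁, t₁, q, t', rfl, h₁, hq₁, h₂, rfl⟩
    · have := hP.1 _ _ hp'
      omega
    · have := hP.1 _ _ h₁
      have := (hR e t₁ ((hP.2 e t₁).1 ⟨_, _, h₁, hq₁⟩)).1 _ _ h₂
      omega
  · intro f t''
    constructor
    · rintro ⟨n, q, hp, hq⟩
      rcases bind_path hp with ⟨q, t', hc, hp⟩ | ⟨n₁, n₂, e, q₁, t₁, q', t', rfl, h₁, hq₁, h₂, hc⟩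
      · cases hc
        simp only [Prog.bind] at hq
        cases h : P.code q <;> simp [h] at hq
      · cases hc
        have hX := (hP.2 e t₁).1 ⟨_, _, h₁, hq₁⟩
        refine ⟨e, t₁, hX, ((hR e t₁ hX).2 f t'').1 ⟨n₂, q', h₂, ?_⟩⟩
        simp only [Prog.bind] at hq
        cases h : (R e).code q' <;> simp_all
    · rintro ⟨e, t', hX, hY⟩
      obtain ⟨n₁, q₁, h₁, hq₁⟩ := (hP.2 e t').2 hX
      obtain ⟨n₂, q₂, h₂, hq₂⟩ := ((hR e t' hX).2 f t'').2 hY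
      have p₁ : StepChain (P.bind R).Step n₁ (.inl P.start, t) (.inl q₁, t') :=
        h₁.map (s := (P.bind R).Step) (fun c : P.Q × Tapes K => (.inl c.1, c.2))
          fun a b hs => bind_step_inl.2 (.inl ⟨_, _, rfl, hs⟩)
      have p₂ : StepChain (P.bind R).Step n₂ (.inr ⟨e, (R e).start⟩, t') (.inr ⟨e, q₂⟩, t'') :=
        h₂.map (s := (P.bind R).Step) (fun c : (R e).Q × Tapes K => (.inr ⟨e, c.1⟩, c.2))
          fun a b hs => bind_step_inr.2 ⟨_, _, rfl, hs⟩
      refine ⟨_, _, (p₁.tail (bind_step_inl.2 (.inr ⟨e, hq₁, rfl⟩))).trans p₂, ?_⟩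
      simp [Prog.bind, hq₂]

end bind

/-! ### More tapes -/

/-- Run `P` on the tapes `g k`; the other tapes are left alone. -/
noncomputable def lift (P : Prog K E) (g : K → K') : Prog K' E where
  Q := P.Q
  finite_states := P.finite_states
  start := P.start
  code q :=
    match P.code q with
    | .inl e => .inl e
    | .inr δ => .inr fun r => {p | ∃ a, (p.1, a) ∈ δ (r ∘ g) ∧
        p.2 = Function.extend g a (Tapes.idle r)}

section lift

variable {P : Prog K E} {g : K → K'}

theorem lift_step (hg : g.Injective) {q q' : P.Q} {t t' : Tapes K'} :
    (P.lift g).Step (q, t) (q', t') ↔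
      P.Step (q, t ∘ g) (q', t' ∘ g) ∧ ∀ k, k ∉ Set.range g → t' k = t k := by
  have key : ∀ a, t' = t.act (Function.extend g a (Tapes.idle t.heads)) ↔
      t' ∘ g = Tapes.act (t ∘ g) a ∧ ∀ k, k ∉ Set.range g → t' k = t k := by
    intro a
    constructor
    · rintro rfl
      refine ⟨funext fun k => ?_, fun k hk => ?_⟩
      · simp [Tapes.act, hg.extend_apply]
      · rw [Tapes.act, Function.extend_apply' _ _ _ (by simpa using hk)]
        exact BitTape.act_idle _
    · rintro ⟨h1, h2⟩
      funext k
      by_cases hk : k ∈ Set.range g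
      · obtain ⟨k, rfl⟩ := hk
        simpa [Tapes.act, hg.extend_apply] using congrFun h1 k
      · rw [h2 k hk, Tapes.act, Function.extend_apply' _ _ _ (by simpa using hk)]
        exact (BitTape.act_idle _).symm
  have hh : t.heads ∘ g = Tapes.heads (t ∘ g) := rfl
  simp only [Step, lift]
  cases h : P.code q with
  | inl e => simp
  | inr δ =>
    constructor
    · rintro ⟨_, _, hδ, hm, ht⟩
      cases hδ
      obtain ⟨a, ha, rfl⟩ := hm
      obtain ⟨h1, h2⟩ := (key a).1 ht
      exact ⟨⟨δ, a, rfl, ha, h1⟩, h2⟩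
    · rintro ⟨⟨_, a, hδ, ha, h1⟩, h2⟩
      cases hδ
      exact ⟨_, _, rfl, ⟨a, ha, rfl⟩, (key a).2 ⟨h1, h2⟩⟩

theorem lift_path (hg : g.Injective) {n : ℕ} {q q' : P.Q} {t t' : Tapes K'} :
    StepChain (P.lift g).Step n (q, t) (q', t') ↔
      StepChain P.Step n (q, t ∘ g) (q', t' ∘ g) ∧ ∀ k, k ∉ Set.range g → t' k = t k := by
  induction n generalizing q' t' with
  | zero =>
    constructor
    · intro h
      cases h
      exact ⟨.refl _, fun _ _ => rfl⟩
    · rintro ⟨h, h'⟩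
      generalize hc : (q, t ∘ g) = c at h
      generalize hd : (q', t' ∘ g) = d at h
      cases h
      rw [← hc] at hd
      obtain ⟨rfl, h2⟩ := Prod.ext_iff.1 hd
      have : t' = t := by
        funext k
        by_cases hk : k ∈ Set.range g
        · obtain ⟨k, rfl⟩ := hk
          exact congrFun h2 k
        · exact h' k hk
      rw [this]
      exact .refl _
  | succ n ih =>
    constructor
    · intro h
      cases h with
      | @tail _ _ b _ h hs =>
        obtain ⟨q₁, t₁⟩ := b
        obtain ⟨h1, h2⟩ := ih.1 h
        obtain ⟨h3, h4⟩ := (lift_step hg).1 hs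
        exact ⟨h1.tail h3, fun k hk => (h4 k hk).trans (h2 k hk)⟩
    · rintro ⟨h, h'⟩
      generalize hd : (q', t' ∘ g) = d at h
      cases h with
      | @tail _ _ b _ h hs =>
        subst hd
        obtain ⟨q₁, t₁⟩ := b
        -- A path of `P` prescribes intermediate contents only for the tapes in the range of `g`; on
        -- the others the initial contents `t` are kept.
        have e1 : Function.extend g t₁ t ∘ g = t₁ := funext fun k => hg.extend_apply _ _ _
        have e2 : ∀ k, k ∉ Set.range g → Function.extend g t₁ t k = t k :=
          fun k hk => Function.extend_apply' _ _ _ (by simpa using hk)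
        refine .tail ((ih (q' := q₁)).2 ⟨?_, e2⟩) ((lift_step hg).2 ⟨?_, fun k hk => ?_⟩)
        · rwa [e1]
        · rwa [e1]
        · rw [h' k hk, e2 k hk]

theorem Spec.lift (hg : g.Injective) {t : Tapes K'} {T : ℕ} {X : E → Tapes K → Prop}
    (h : P.Spec (t ∘ g) T X) :
    (P.lift g).Spec t T fun e t' => X e (t' ∘ g) ∧ ∀ k, k ∉ Set.range g → t' k = t k := by
  constructor
  · rintro n ⟨q, t'⟩ hp
    exact h.1 _ _ ((lift_path hg).1 hp).1
  · intro e t'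
    have hcode : ∀ q, (P.lift g).code q = .inl e ↔ P.code q = .inl e := by
      intro q
      simp only [Prog.lift]
      cases P.code q <;> simp
    show _ ↔ X e (t' ∘ g) ∧ _
    rw [← h.2 e (t' ∘ g)]
    constructor
    · rintro ⟨n, q, hp, hq⟩
      obtain ⟨h1, h2⟩ := (lift_path hg).1 hp
      exact ⟨⟨n, q, h1, (hcode q).1 hq⟩, h2⟩
    · rintro ⟨⟨n, q, hp, hq⟩, h2⟩
      exact ⟨n, q, (lift_path hg).2 ⟨hp, h2⟩, (hcode q).2 hq⟩

end lift

end Prog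

/-! ### Words on tapes -/

theorem blankFreePrefix_cons_some (b : Bool) (l : Turing.ListBlank (Option Bool)) :
    blankFreePrefix (l.cons (some b)) = b :: blankFreePrefix l :=
  l.induction_on fun u => by
    rw [Turing.ListBlank.cons_mk]
    exact List.reduceOption_cons_of_some b (u.takeWhile Option.isSome)

theorem blankFreePrefix_cons_none (l : Turing.ListBlank (Option Bool)) :
    blankFreePrefix (l.cons none) = [] :=
  l.induction_on fun u => by
    rw [Turing.ListBlank.cons_mk]
    rfl

theorem blankFreePrefix_mk (u : List (Option Bool)) :
    blankFreePrefix (.mk u) = (u.takeWhile Option.isSome).reduceOption := rfl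

theorem mk_append_none (l : List (Option Bool)) :
    Turing.ListBlank.mk (l ++ [none]) = Turing.ListBlank.mk l :=
  (Quotient.sound' (.inl ⟨1, rfl⟩) : Turing.ListBlank.mk l = Turing.ListBlank.mk (l ++ [none])).symm

namespace BitTape

theorem word_of_head_none {T : BitTape} (h : T.head = none) : T.word = [] := by
  rw [word, Turing.Tape.right₀, h, blankFreePrefix_cons_none]

theorem word_of_head_some {T : BitTape} {b : Bool} (h : T.head = some b) :
    T.word = b :: word (T.move .right) := by
  rw [word, word, Turing.Tape.right₀, h, blankFreePrefix_cons_some]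
  congr 2
  rcases T with ⟨a, L, R⟩
  exact (Turing.ListBlank.cons_head_tail R).symm

theorem head?_word (T : BitTape) : T.word.head? = T.head := by
  cases h : T.head with
  | none => rw [word_of_head_none h, List.head?_nil]
  | some b => rw [word_of_head_some h, List.head?_cons]

@[simp] theorem word_ofWord (w : List Bool) : (ofWord w).word = w := by
  show blankFreePrefix (Turing.Tape.mk' _ (.mk (w.map some))).right₀ = w
  rw [Turing.Tape.mk'_right₀, blankFreePrefix_mk, List.takeWhile_eq_self_iff.2 (by
    intro a ha
    obtain ⟨b, -, rfl⟩ := List.mem_map.1 ha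
    rfl)]
  simp [List.reduceOption]

/-- Prepending a bit to the word on a tape. -/
theorem word_write_move_left (T : BitTape) (b : Bool) :
    word ((T.move .left).write (some b)) = b :: T.word := by
  rw [word_of_head_some (T := (T.move .left).write (some b)) (b := b) rfl]
  congr 1
  rcases T with ⟨a, L, R⟩
  simp [word, Turing.Tape.move, Turing.Tape.write, Turing.Tape.right₀]

theorem act_idle_move (T : BitTape) (d : Turing.Dir) : T.act (T.head, some d) = T.move d := by
  show (T.write T.head).move d = _
  rw [Turing.Tape.write_self]

theorem act_erase_ofWord (w : List Bool) : (ofWord w).act (none, some .right) = ofWord w.tail := by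
  show Turing.Tape.move .right (Turing.Tape.write none (Turing.Tape.mk' (.mk []) (.mk _))) =
    Turing.Tape.mk' (.mk []) (.mk _)
  have h : ∀ w : List Bool, Turing.ListBlank.mk (w.map some) =
      (Turing.ListBlank.mk (w.tail.map some)).cons w.head? := by
    rintro (_ | ⟨b, w⟩)
    · exact (mk_append_none []).symm
    · rfl
  rw [h, Turing.Tape.write_mk', Turing.Tape.move_right_mk', Turing.ListBlank.head_cons,
    Turing.ListBlank.tail_cons]
  congr 1
  exact mk_append_none []

/-- The tape with `v` to the right of the head, beginning in the scanned cell, and the reverse of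
`u` to the left. -/
def split (u v : List (Option Bool)) : BitTape := Turing.Tape.mk₂ u v

theorem split_move_left (a : Option Bool) (u v : List (Option Bool)) :
    Turing.Tape.move .left (split (a :: u) v) = split u (a :: v) :=
  Turing.Tape.move_left_mk' _ _

theorem split_append_none_right (u v : List (Option Bool)) :
    split u (v ++ [none]) = split u v := by
  simp only [split, Turing.Tape.mk₂, mk_append_none]

theorem split_append_none_left (u v : List (Option Bool)) :
    split (u ++ [none]) v = split u v := by
  simp only [split, Turing.Tape.mk₂, mk_append_none]

theorem ofWord_eq_split (w : List Bool) : ofWord w = split [] (w.map some) := rfl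

/-- The non-blank cells of the tape lie in an interval of at most `m + 1` cells that contains the
scanned cell. -/
def Fits (T : BitTape) (m : ℕ) : Prop :=
  ∃ u a v, T = split u (a :: v) ∧ u.length + v.length ≤ m

/-- The window grows only when the head leaves it, and then by one blank cell. -/
theorem Fits.act {T : BitTape} {m : ℕ} (h : T.Fits m) (a : TapeAct) : (T.act a).Fits (m + 1) := by
  obtain ⟨u, b, v, rfl, hm⟩ := h
  obtain ⟨c, d⟩ := a
  rcases d with _ | _ | _
  · exact ⟨u, c, v, rfl, by omega⟩
  · cases u with
    | nil =>
      rw [← split_append_none_left]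
      exact ⟨[], none, c :: v, rfl, by simp at *; omega⟩
    | cons e u => exact ⟨u, e, c :: v, rfl, by simp at *; omega⟩
  · cases v with
    | nil =>
      rw [← split_append_none_right]
      exact ⟨c :: u, none, [], rfl, by simp at *; omega⟩
    | cons e v => exact ⟨c :: u, e, v, rfl, by simp at *; omega⟩

theorem fits_ofWord (w : List Bool) : (ofWord w).Fits w.length := by
  rw [ofWord_eq_split, ← split_append_none_right]
  cases w with
  | nil => exact ⟨[], none, [], rfl, by simp⟩
  | cons b w => exact ⟨[], some b, w.map some ++ [none], rfl, by simp⟩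

theorem Fits.length_word {T : BitTape} {m : ℕ} (h : T.Fits m) : T.word.length ≤ m + 1 := by
  obtain ⟨u, b, v, rfl, hm⟩ := h
  show (blankFreePrefix (Turing.Tape.mk' _ (.mk (b :: v))).right₀).length ≤ _
  rw [Turing.Tape.mk'_right₀, blankFreePrefix_mk]
  refine (List.reduceOption_length_le _).trans ((List.takeWhile_sublist _).length_le.trans ?_)
  simp
  omega

end BitTape

namespace Prog

variable {K E : Type}

theorem fits_of_chain {P : Prog K E} {n m : ℕ} {c d : P.Q × Tapes K} {k : K}
    (h : StepChain P.Step n c d) (hc : (c.2 k).Fits m) : (d.2 k).Fits (m + n) := by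
  induction h with
  | refl => exact hc
  | tail _ hs ih =>
    obtain ⟨δ, a, -, -, hd⟩ := hs
    rw [hd]
    exact (ih hc).act _

/-- The non-blank part of a tape grows by at most one cell per step. Intermediate results therefore
have polynomial length, which keeps the running time of composed programs polynomial. -/
theorem Spec.length_word {P : Prog K E} {T : ℕ} {i o : K} {x : List Bool}
    {X : E → Tapes K → Prop} (h : P.Spec (Tapes.input i x) T X) {e : E} {t' : Tapes K}
    (ht : X e t') : (t' o).word.length ≤ x.length + T + 1 := by
  obtain ⟨n, q, hp, -⟩ := (h.2 e t').2 ht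
  have hf : (Tapes.input i x o).Fits x.length := by
    unfold Tapes.input
    split_ifs
    · exact BitTape.fits_ofWord x
    · obtain ⟨u, a, v, h1, h2⟩ := BitTape.fits_ofWord []
      exact ⟨u, a, v, h1, h2.trans (Nat.zero_le _)⟩
  have : (t' o).word.length ≤ _ := (fits_of_chain (k := o) hp hf).length_word
  have := h.1 _ _ hp
  omega

/-! ### Copying a word -/

open Classical in
/-- Copy the word on tape `s` to the tapes in `D`, leaving the heads behind its last symbol. -/
noncomputable def copyForward (s : K) (D : Set K) : Prog K Unit :=
  iter fun r => {match r s with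
    | none => (some (), fun k => if k ∈ D then (none, some .left) else (r k, none))
    | some b => (none, fun k =>
        if k ∈ D then (some b, some .right) else (r k, if k = s then some .right else none))}

open Classical in
/-- Move the heads on the tapes in `D` left until a blank is scanned on tape `d`, and then one cell
to the right. -/
noncomputable def rewind (d : K) (D : Set K) : Prog K Unit :=
  iter fun r => {match r d with
    | none => (some (), fun k => (r k, if k ∈ D then some .right else none))
    | some _ => (none, fun k => (r k, if k ∈ D then some .left else none))}

/-- Copy the word on tape `s` to the tapes in `D`, one of which is `d`. -/
noncomputable def copy (s d : K) (D : Set K) : Prog K Unit :=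
  (copyForward s D).bind fun _ => rewind d D

open Classical in
-- For the induction, `u` is the part already copied, in reverse order to the left of the heads. The
-- last round moves these heads left, as `rewind` expects.
theorem copyForward_spec {s : K} {D : Set K} (hs : s ∉ D) (w : List Bool)
    (u : List (Option Bool)) (t : Tapes K) (hw : (t s).word = w)
    (ht : ∀ k ∈ D, t k = BitTape.split u []) :
    ∃ t', (∀ k ∈ D, t' k = (BitTape.split ((w.map some).reverse ++ u) []).act (none, some .left)) ∧
      (∀ k ∉ D, k ≠ s → t' k = t k) ∧
      (copyForward s D).Spec t (w.length + 1) fun _ t'' => t'' = t' := by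
  induction w generalizing t u with
  | nil =>
    have hh : (t s).head = none := by rw [← BitTape.head?_word, hw, List.head?_nil]
    refine ⟨t.act fun k => if k ∈ D then (none, some .left) else (t.heads k, none),
      fun k hk => ?_, fun k hk _ => ?_, ?_⟩
    · simp [Tapes.act, hk, ht k hk]
    · simp only [Tapes.act, if_neg hk]
      exact BitTape.act_idle _
    · refine (iter_spec_exit (e := ()) ?_).mono le_rfl fun _ t'' => and_iff_right rfl
      simp only [Tapes.heads, hh]
  | cons b w ih =>
    have hh : (t s).head = some b := by rw [← BitTape.head?_word, hw, List.head?_cons]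
    set t₁ := t.act fun k => if k ∈ D then (some b, some .right)
      else (t.heads k, if k = s then some .right else none) with ht₁
    have h1 : (t₁ s).word = w := by
      have : t₁ s = (t s).move .right := by
        simp only [ht₁, Tapes.act, if_neg hs, if_true]
        exact BitTape.act_idle_move _ _
      rw [this]
      rw [BitTape.word_of_head_some hh] at hw
      exact (List.cons.inj hw).2
    have h2 : ∀ k ∈ D, t₁ k = BitTape.split (some b :: u) [] := by
      intro k hk
      simp only [ht₁, Tapes.act, if_pos hk, ht k hk]
      rw [← BitTape.split_append_none_right]
      rfl
    obtain ⟨t', h3, h4, h5⟩ := ih (some b :: u) t₁ h1 h2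
    refine ⟨t', fun k hk => ?_, fun k hk hks => ?_, iter_spec_loop ?_ h5⟩
    · rw [h3 k hk]
      simp
    · rw [h4 k hk hks]
      simp only [ht₁, Tapes.act, if_neg hk, if_neg hks]
      exact BitTape.act_idle _
    · simp only [Tapes.heads, hh]

open Classical in
-- For the induction, `v` is the part of the word already passed and `u` the rest, nearest symbol
-- first. Starting one cell further left makes the empty word no exception. The heads on `D` move in
-- lockstep over equal contents, so reading tape `d` suffices.
theorem rewind_spec {d : K} {D : Set K} (hd : d ∈ D) (u v : List Bool) (t : Tapes K)
    (ht : ∀ k ∈ D, t k = (BitTape.split (u.map some) (v.map some)).move .left) :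
    ∃ t', (∀ k ∈ D, t' k = BitTape.ofWord (u.reverse ++ v)) ∧ (∀ k ∉ D, t' k = t k) ∧
      (rewind d D).Spec t (u.length + 1) fun _ t'' => t'' = t' := by
  induction u generalizing v t with
  | nil =>
    have hh : (t d).head = none := by rw [ht d hd]; rfl
    refine ⟨t.act fun k => (t.heads k, if k ∈ D then some .right else none),
      fun k hk => ?_, fun k hk => ?_, ?_⟩
    · simp only [Tapes.act, if_pos hk]
      refine (BitTape.act_idle_move _ _).trans ?_
      rw [ht k hk, Turing.Tape.move_left_right]
      rfl
    · simp only [Tapes.act, if_neg hk]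
      exact BitTape.act_idle _
    · refine (iter_spec_exit (e := ()) ?_).mono le_rfl fun _ t'' => and_iff_right rfl
      simp only [Tapes.heads, hh]
  | cons b u ih =>
    have hh : (t d).head = some b := by rw [ht d hd]; rfl
    set t₁ := t.act fun k => (t.heads k, if k ∈ D then some .left else none) with ht₁
    obtain ⟨t', h1, h2, h3⟩ := ih (b :: v) t₁ fun k hk => by
      simp only [ht₁, Tapes.act, if_pos hk]
      refine (BitTape.act_idle_move _ _).trans ?_
      rw [ht k hk]
      exact congrArg _ (BitTape.split_move_left _ _ _)
    refine ⟨t', fun k hk => ?_, fun k hk => ?_, iter_spec_loop ?_ h3⟩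
    · rw [h1 k hk]
      simp
    · rw [h2 k hk]
      simp only [ht₁, Tapes.act, if_neg hk]
      exact BitTape.act_idle _
    · simp only [Tapes.heads, hh]

theorem copy_spec {s d : K} {D : Set K} (hs : s ∉ D) (hd : d ∈ D) (t : Tapes K)
    (ht : ∀ k ∈ D, t k = default) :
    ∃ t', (∀ k ∈ D, t' k = BitTape.ofWord (t s).word) ∧ (∀ k ∉ D, k ≠ s → t' k = t k) ∧
      (copy s d D).Spec t (2 * (t s).word.length + 3) fun _ t'' => t'' = t' := by
  set w := (t s).word with hw
  obtain ⟨t₁, h1, h2, h3⟩ := copyForward_spec hs w [] t hw.symm ht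
  obtain ⟨t₂, h4, h5, h6⟩ := rewind_spec hd w.reverse [] t₁ fun k hk => by
    rw [h1 k hk, List.append_nil, List.map_reverse]
    rfl
  refine ⟨t₂, fun k hk => ?_, fun k hk hks => ?_, ?_⟩
  · rw [h4 k hk, List.reverse_reverse, List.append_nil]
  · rw [h5 k fun h => hk h, h2 k hk hks]
  · refine (h3.bind (T₂ := w.reverse.length + 1) (R := fun _ => rewind d D)
      (Y := fun _ _ _ t'' => t'' = t₂) ?_).mono ?_ ?_
    · rintro _ _ rfl
      exact h6
    · rw [List.length_reverse]
      omega
    · simp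

end Prog

/-! ### Output words of programs, and some small programs. -/

namespace Prog

variable {K K' E F : Type}

/-- Started with the tapes `t`, the program runs for at most `T` steps, and `V` describes the words
that can be on tape `o` when it exits. -/
def Outputs (P : Prog K Unit) (t : Tapes K) (T : ℕ) (o : K) (V : List Bool → Prop) : Prop :=
  P.Bounded t T ∧ ∀ v, (∃ t', P.Exits t () t' ∧ (t' o).word = v) ↔ V v

theorem Outputs.mono {P : Prog K Unit} {t : Tapes K} {T T' : ℕ} {o : K} {V V' : List Bool → Prop}
    (h : P.Outputs t T o V) (hT : T ≤ T') (hV : ∀ v, V v ↔ V' v) : P.Outputs t T' o V' :=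
  ⟨fun n c hp => (h.1 n c hp).trans hT, fun v => (h.2 v).trans (hV v)⟩

theorem Spec.outputs {P : Prog K Unit} {t : Tapes K} {T : ℕ} {X : Unit → Tapes K → Prop}
    (h : P.Spec t T X) (o : K) : P.Outputs t T o fun v => ∃ t', X () t' ∧ (t' o).word = v :=
  ⟨h.1, fun v => by simp only [h.2]⟩

theorem Outputs.spec {P : Prog K Unit} {t : Tapes K} {T : ℕ} {o : K} {V : List Bool → Prop}
    (h : P.Outputs t T o V) : P.Spec t T (P.Exits t) := h.1.spec

theorem Outputs.lift {P : Prog K Unit} {g : K → K'} (hg : g.Injective) {t : Tapes K'} {T : ℕ}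
    {o : K} {V : List Bool → Prop} (h : P.Outputs (t ∘ g) T o V) :
    (P.lift g).Outputs t T (g o) V := by
  refine ((h.spec.lift hg).outputs (g o)).mono le_rfl fun v => ?_
  rw [← h.2 v]
  constructor
  · rintro ⟨t', ⟨h1, -⟩, h2⟩
    exact ⟨_, h1, h2⟩
  · rintro ⟨t', h1, h2⟩
    have e1 : Function.extend g t' t ∘ g = t' := funext fun k => hg.extend_apply _ _ _
    refine ⟨Function.extend g t' t, ⟨?_, fun k hk => ?_⟩, ?_⟩
    · rwa [e1]
    · exact Function.extend_apply' _ _ _ (by simpa using hk)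
    · rwa [hg.extend_apply]

theorem Spec.bind_outputs [Finite E] {P : Prog K E} {R : E → Prog K Unit} {t : Tapes K}
    {T₁ T₂ : ℕ} {o : K} {X : E → Tapes K → Prop} {V : E → Tapes K → List Bool → Prop}
    (hP : P.Spec t T₁ X) (hR : ∀ e t', X e t' → (R e).Outputs t' T₂ o (V e t')) :
    (P.bind R).Outputs t (T₁ + 1 + T₂) o fun v => ∃ e t', X e t' ∧ V e t' v := by
  refine ((hP.bind fun e t' hX => (hR e t' hX).spec).outputs o).mono le_rfl fun v => ?_
  constructor
  · rintro ⟨t'', ⟨e, t', hX, hY⟩, hv⟩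
    exact ⟨e, t', hX, ((hR e t' hX).2 v).1 ⟨t'', hY, hv⟩⟩
  · rintro ⟨e, t', hX, hV⟩
    obtain ⟨t'', hY, hv⟩ := ((hR e t' hX).2 v).2 hV
    exact ⟨t'', ⟨e, t', hX, hY⟩, hv⟩

/-- Exit at once, with a label that depends on the scanned symbols. -/
def exit [Finite E] (f : (K → Option Bool) → E) : Prog K E :=
  iter fun r => {(some (f r), Tapes.idle r)}

theorem exit_spec [Finite E] (f : (K → Option Bool) → E) (t : Tapes K) :
    (exit f).Spec t 1 fun e t' => e = f t.heads ∧ t' = t :=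
  (iter_spec_exit rfl).mono le_rfl fun e t' => by rw [Tapes.act_idle]

/-- A program that never exits. -/
def fail : Prog K E where
  Q := Unit
  finite_states := inferInstance
  start := ()
  code _ := .inr fun _ => ∅

theorem fail_spec (t : Tapes K) : (fail : Prog K E).Spec t 0 fun _ _ => False := by
  constructor
  · intro n c hp
    rcases hp.cases_head with ⟨rfl, -⟩ | ⟨_, _, -, ⟨δ, a, hδ, ha, -⟩, -⟩
    · exact le_rfl
    · cases hδ
      exact ha.elim
  · intro e t'
    constructor
    · rintro ⟨_, _, -, h⟩
      cases h
    · exact False.elim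

open Classical in
/-- Prepend a bit from `S` to the word on tape `o`. -/
noncomputable def prepend (o : K) (S : Set Bool) : Prog K Unit :=
  (iter (E := Unit) fun r => {(some (), fun k => (r k, if k = o then some .left else none))}).bind
    fun _ => iter fun r =>
      {p | ∃ b ∈ S, p = (some (), fun k => (if k = o then some b else r k, none))}

theorem prepend_outputs (o : K) (S : Set Bool) (t : Tapes K) :
    (prepend o S).Outputs t 4 o fun v => ∃ b ∈ S, v = b :: (t o).word := by
  classical
  have h1 := iter_spec_exit (K := K) (E := Unit) (t := t)
    (f := fun r => {(some (), fun k => (r k, if k = o then some .left else none))}) rfl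
  refine (h1.bind_outputs (T₂ := 2) (V := fun _ _ v => ∃ b ∈ S, v = b :: (t o).word) ?_).mono
    le_rfl fun v => ?_
  · rintro e t' ⟨-, rfl⟩
    refine ((iter_spec (T := 1) (X := fun _ _ _ => False) ?_).outputs o).mono le_rfl fun v => ?_
    · rintro a ⟨b, -, hb⟩
      cases hb
    · simp only [Set.mem_ofPred_eq, Prod.mk.injEq, true_and, reduceCtorEq, false_and, and_false,
        exists_false, or_false]
      have key : ∀ b : Bool, BitTape.word (Tapes.act (t.act fun k => (t.heads k,
          if k = o then some .left else none)) (fun k => (if k = o then some b else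
            Tapes.heads (t.act fun k => (t.heads k, if k = o then some .left else none)) k,
              none)) o) = b :: (t o).word := by
        intro b
        rw [← BitTape.word_write_move_left]
        simp only [Tapes.act, if_true]
        have := BitTape.act_idle_move (t o) .left
        rw [← this]
        rfl
      constructor
      · rintro ⟨t', ⟨a, ⟨b, hb, rfl⟩, rfl⟩, rfl⟩
        exact ⟨b, hb, key b⟩
      · rintro ⟨b, hb, rfl⟩
        exact ⟨_, ⟨_, ⟨b, hb, rfl⟩, rfl⟩, key b⟩
  · constructor
    · rintro ⟨-, -, -, h⟩
      exact h
    · exact fun h => ⟨(), _, ⟨rfl, rfl⟩, h⟩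

end Prog

/-! ### Multivalued functions and their composition. -/

/-- Nondeterministic polynomial-time multivalued functions: `R x w` says that some accepting path
on input `x` outputs `w`. -/
def NPMV (R : List Bool → List Bool → Prop) : Prop :=
  ∃ (K : Type) (_ : Finite K) (P : Prog K Unit) (i o : K) (p : Polynomial ℕ),
    ∀ x, P.Outputs (Tapes.input i x) (p.eval x.length) o (R x)

theorem Polynomial.eval_nat_mono (p : Polynomial ℕ) {m n : ℕ} (h : m ≤ n) :
    p.eval m ≤ p.eval n := by
  rw [Polynomial.eval_eq_sum, Polynomial.eval_eq_sum]
  exact Finset.sum_le_sum fun i _ => Nat.mul_le_mul_left _ (Nat.pow_le_pow_left h i)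

namespace NPMV

variable {R S : List Bool → List Bool → Prop}

theorem congr (h : NPMV R) (hS : ∀ x w, R x w ↔ S x w) : NPMV S := by
  obtain rfl : R = S := funext fun x => funext fun w => propext (hS x w)
  exact h

theorem empty : NPMV fun _ _ => False :=
  ⟨Unit, inferInstance, Prog.fail, (), (), 0, fun _ =>
    ((Prog.fail_spec _).outputs ()).mono (Nat.zero_le _) fun v => by simp⟩

theorem input_unit (x : List Bool) : Tapes.input () x () = BitTape.ofWord x := by
  simp [Tapes.input]

theorem id : NPMV fun x w => w = x :=
  ⟨Unit, inferInstance, Prog.exit fun _ => (), (), (), 1, fun x =>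
    ((Prog.exit_spec _ _).outputs ()).mono (by simp) fun v => by
      simp [input_unit, eq_comm]⟩

/-- With `S = Set.univ` this guesses a bit. -/
theorem prepend (S : Set Bool) : NPMV fun x w => ∃ b ∈ S, w = b :: x :=
  ⟨Unit, inferInstance, Prog.prepend () S, (), (), 4, fun x =>
    (Prog.prepend_outputs () S _).mono (by simp) fun v => by simp [input_unit]⟩

theorem cons (b : Bool) : NPMV fun x w => w = b :: x :=
  (prepend {b}).congr fun x w => by simp

theorem tail : NPMV fun x w => w = x.tail :=
  ⟨Unit, inferInstance, Prog.iter fun _ => {(some (), fun _ => (none, some .right))}, (), (), 1,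
    fun x => ((Prog.iter_spec_exit rfl).outputs ()).mono (by simp) fun v => by
      simp [Tapes.act, input_unit, BitTape.act_erase_ofWord, eq_comm]⟩

end NPMV

theorem Tapes.input_comp {K K' : Type} {g : K → K'} (hg : g.Injective) (i : K) (x : List Bool) :
    Tapes.input (g i) x ∘ g = Tapes.input i x := by
  funext k
  by_cases hk : k = i
  · simp [Tapes.input, hk]
  · simp [Tapes.input, hk, hg.ne hk]

namespace Prog

variable {K : Type}

theorem copy_bind_outputs {s d : K} {D : Set K} (hs : s ∉ D) (hd : d ∈ D) {t : Tapes K}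
    (ht : ∀ k ∈ D, t k = default) {R : Prog K Unit} {ℓ T : ℕ} {o : K} {V : List Bool → Prop}
    (hℓ : (t s).word.length ≤ ℓ)
    (hR : ∀ t' : Tapes K, (∀ k ∈ D, t' k = BitTape.ofWord (t s).word) →
      (∀ k ∉ D, k ≠ s → t' k = t k) → R.Outputs t' T o V) :
    ((copy s d D).bind fun _ => R).Outputs t (2 * ℓ + 4 + T) o V := by
  obtain ⟨t₁, h1, h2, h3⟩ := copy_spec hs hd t ht
  refine (h3.bind_outputs (V := fun _ _ => V) (T₂ := T) ?_).mono (by omega) fun v => by simp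
  rintro _ _ rfl
  exact hR _ h1 h2

theorem copy_outputs {s d : K} {D : Set K} (hs : s ∉ D) (hd : d ∈ D) {t : Tapes K}
    (ht : ∀ k ∈ D, t k = default) {ℓ : ℕ} (hℓ : (t s).word.length ≤ ℓ) :
    (copy s d D).Outputs t (2 * ℓ + 3) d fun v => v = (t s).word := by
  obtain ⟨t₁, h1, -, h3⟩ := copy_spec hs hd t ht
  refine (h3.outputs d).mono (by omega) fun v => ?_
  simp [h1 d hd, eq_comm]

end Prog

namespace NPMV

variable {R : List Bool → List Bool → Prop}

/-- Run one machine on the output of another. -/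
theorem comp {S : List Bool → List Bool → Prop} (hR : NPMV R) (hS : NPMV S) :
    NPMV fun x w => ∃ y, R x y ∧ S y w := by
  obtain ⟨K₁, _, P₁, i₁, o₁, p₁, h₁⟩ := hR
  obtain ⟨K₂, _, P₂, i₂, o₂, p₂, h₂⟩ := hS
  -- A bound for the length of the intermediate word: input length plus running time plus one.
  let ℓ : Polynomial ℕ := .X + p₁ + 1
  refine ⟨K₁ ⊕ K₂, inferInstance, (P₁.lift .inl).bind fun _ =>
    (Prog.copy (.inl o₁) (.inr i₂) {.inr i₂}).bind fun _ => P₂.lift .inr, .inl i₁, .inr o₂,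
    p₁ + 1 + (2 * ℓ + 4 + p₂.comp ℓ), fun x => ?_⟩
  have e1 : Tapes.input (Sum.inl i₁ : K₁ ⊕ K₂) x ∘ Sum.inl = Tapes.input i₁ x :=
    Tapes.input_comp Sum.inl_injective i₁ x
  have e2 : ∀ k : K₂, Tapes.input (Sum.inl i₁ : K₁ ⊕ K₂) x (Sum.inr k) = default := by
    simp [Tapes.input]
  have hP := h₁ x
  rw [← e1] at hP
  have hlift := hP.spec.lift Sum.inl_injective
  refine (hlift.bind_outputs (V := fun _ t' v => S (t' (.inl o₁)).word v)
    (T₂ := 2 * ℓ.eval x.length + 4 + p₂.eval (ℓ.eval x.length)) ?_).mono ?_ fun v => ?_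
  · rintro _ t' ⟨hX, hk⟩
    have hb : ∀ k : K₂, t' (.inr k) = default := fun k => by rw [hk _ (by simp), e2]
    have hlen : (t' (.inl o₁)).word.length ≤ ℓ.eval x.length := by
      rw [e1] at hP hX
      simpa [ℓ] using hP.spec.length_word (o := o₁) hX
    refine Prog.copy_bind_outputs (by simp) (Set.mem_singleton _) (by simp [hb]) hlen ?_
    intro t'' h3 h4
    have e3 : t'' ∘ Sum.inr = Tapes.input i₂ (t' (.inl o₁)).word := by
      funext k
      by_cases hki : k = i₂
      · subst hki
        simp [Tapes.input, h3]
      · simp only [Function.comp, Tapes.input, if_neg hki]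
        rw [h4 _ (by simpa using hki) (by simp), hb]
    have hP₂ := h₂ (t' (.inl o₁)).word
    rw [← e3] at hP₂
    exact (hP₂.mono (p₂.eval_nat_mono hlen) fun _ => Iff.rfl).lift Sum.inr_injective
  · simp [Polynomial.eval_comp]
  · constructor
    · rintro ⟨_, t', ⟨hX, -⟩, hV⟩
      exact ⟨_, (hP.2 _).1 ⟨_, hX, rfl⟩, hV⟩
    · rintro ⟨y, hy, hV⟩
      obtain ⟨t', ht', h⟩ := ((hP.lift Sum.inl_injective).2 y).2 hy
      refine ⟨(), t', (hlift.2 _ _).1 ht', ?_⟩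
      rwa [h]

/-- Run one machine and then, on the same input, a second one which depends on the first symbol
of the output of the first one. -/
theorem branch {S : Option Bool → List Bool → List Bool → Prop} (hR : NPMV R)
    (hS : ∀ a, NPMV (S a)) : NPMV fun x v => ∃ w, R x w ∧ S w.head? x v := by
  obtain ⟨K₁, _, P₁, i₁, o₁, p₁, h₁⟩ := hR
  choose K₂ _ P₂ i₂ o₂ p₂ h₂ using hS
  -- The two additional tapes are the common input tape `false` and the common output tape `true`.
  -- The latter is needed because the output tape of the second machine depends on `a`.
  let g₁ : K₁ → Bool ⊕ K₁ ⊕ Σ a, K₂ a := fun k => .inr (.inl k)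
  let g₂ : ∀ a, K₂ a → Bool ⊕ K₁ ⊕ Σ a, K₂ a := fun a k => .inr (.inr ⟨a, k⟩)
  have hg₁ : g₁.Injective := fun k k' h => by simpa [g₁] using h
  have hg₂ : ∀ a, (g₂ a).Injective := fun a k k' h => by simpa [g₂] using h
  -- The input is copied at the outset to the input tapes of the first machine and of all candidates
  -- for the second, as the first machine may destroy its own copy.
  let D : Set (Bool ⊕ K₁ ⊕ Σ a, K₂ a) := {k | k = g₁ i₁ ∨ ∃ a, k = g₂ a (i₂ a)}
  -- One bound for all the second machines: there are only three values of `a`.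
  let q : Polynomial ℕ := ∑ a, p₂ a
  have hq : ∀ a n, (p₂ a).eval n ≤ q.eval n := fun a n => by
    rw [Polynomial.eval_finsetSum]
    exact Finset.single_le_sum (f := fun a => (p₂ a).eval n) (fun _ _ => Nat.zero_le _)
      (Finset.mem_univ a)
  let ℓ : Polynomial ℕ := .X + q + 1
  refine ⟨Bool ⊕ K₁ ⊕ Σ a, K₂ a, inferInstance, (Prog.copy (.inl false) (g₁ i₁) D).bind fun _ =>
    (P₁.lift g₁).bind fun _ => (Prog.exit fun r => r (g₁ o₁)).bind fun a =>
      ((P₂ a).lift (g₂ a)).bind fun _ => Prog.copy (g₂ a (o₂ a)) (.inl true) {.inl true},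
    .inl false, .inl true, 2 * .X + 4 + (p₁ + 1 + (2 + (q + 1 + (2 * ℓ + 3)))), fun x => ?_⟩
  set t₀ : Tapes (Bool ⊕ K₁ ⊕ Σ a, K₂ a) := Tapes.input (.inl false) x with ht₀
  have e0 : (t₀ (.inl false)).word = x := by simp [ht₀, Tapes.input]
  have e1 : ∀ k, k ≠ .inl false → t₀ k = default := fun k hk => by simp [ht₀, Tapes.input, hk]
  have hb : ∀ b, Sum.inl b ∉ D := fun b hb => by simp [D, g₁, g₂] at hb
  have hne : ∀ k ∈ D, k ≠ .inl false := by
    rintro _ hk rfl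
    exact hb _ hk
  have key : ∀ t : Tapes (Bool ⊕ K₁ ⊕ Σ a, K₂ a),
      (∀ k ∈ D, t k = BitTape.ofWord (t₀ (.inl false)).word) →
      (∀ k ∉ D, k ≠ .inl false → t k = t₀ k) →
      ((P₁.lift g₁).bind fun _ => (Prog.exit fun r => r (g₁ o₁)).bind fun a =>
        ((P₂ a).lift (g₂ a)).bind fun _ =>
          Prog.copy (g₂ a (o₂ a)) (.inl true) {.inl true}).Outputs t
        (p₁.eval x.length + 1 + (2 + (q.eval x.length + 1 + (2 * ℓ.eval x.length + 3))))
        (.inl true) fun v => ∃ w, R x w ∧ S w.head? x v := by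
    intro t h3 h4
    rw [e0] at h3
    have h5 : ∀ k, k ∉ D → k ≠ .inl false → t k = default := fun k hk hk' => by
      rw [h4 k hk hk', e1 k hk']
    have f1 : t ∘ g₁ = Tapes.input i₁ x := by
      funext k
      by_cases hk : k = i₁
      · subst hk
        simp [Tapes.input, h3 (g₁ k) (.inl rfl)]
      · simp only [Function.comp, Tapes.input, if_neg hk]
        exact h5 _ (by simpa [D, g₁, g₂] using hk) (by simp [g₁])
    have f2 : ∀ a, t ∘ g₂ a = Tapes.input (i₂ a) x := by
      intro a
      funext k
      by_cases hk : k = i₂ a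
      · subst hk
        simp [Tapes.input, h3 (g₂ a (i₂ a)) (.inr ⟨a, rfl⟩)]
      · simp only [Function.comp, Tapes.input, if_neg hk]
        refine h5 _ ?_ (by simp [g₂])
        rintro (h | ⟨a', h⟩)
        · simp [g₁, g₂] at h
        · obtain ⟨rfl, h⟩ : a = a' ∧ HEq k (i₂ a') := by simpa [g₂] using h
          exact hk (eq_of_heq h)
    have hP := h₁ x
    rw [← f1] at hP
    have hlift := hP.spec.lift hg₁
    refine (hlift.bind_outputs (V := fun _ t' v => S (t' (g₁ o₁)).head x v) ?_).mono le_rfl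
      fun v => ?_
    · rintro _ t' ⟨hX, hk⟩
      refine ((Prog.exit_spec _ t').bind_outputs (V := fun a _ => S a x)
        (T₂ := q.eval x.length + 1 + (2 * ℓ.eval x.length + 3)) ?_).mono (by omega) fun v => ?_
      · rintro a t₁ ⟨-, ht₁⟩
        subst t₁
        have f3 : t' ∘ g₂ a = Tapes.input (i₂ a) x := by
          rw [← f2 a]
          funext k
          exact hk _ (by simp [g₁, g₂])
        have hP₂ := (h₂ a x).mono (hq a x.length) fun _ => Iff.rfl
        have hP₂' := hP₂
        rw [← f3] at hP₂'
        have hlift₂ := hP₂'.spec.lift (hg₂ a)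
        refine (hlift₂.bind_outputs (V := fun _ t'' v => v = (t'' (g₂ a (o₂ a))).word)
          (T₂ := 2 * ℓ.eval x.length + 3) ?_).mono le_rfl fun v => ?_
        · rintro _ t'' ⟨hX₂, hk₂⟩
          refine Prog.copy_outputs (by simp [g₂]) (Set.mem_singleton _) ?_ ?_
          · rintro _ rfl
            rw [hk₂ _ (by simp [g₂]), hk _ (by simp [g₁]), h5 _ (hb _) (by simp)]
          · rw [f3] at hX₂
            simpa [ℓ] using hP₂.spec.length_word (o := o₂ a) hX₂
        · rw [← hP₂'.2 v]
          constructor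
          · rintro ⟨_, t'', ⟨hX₂, -⟩, rfl⟩
            exact ⟨_, hX₂, rfl⟩
          · rintro h
            obtain ⟨t'', ht'', hv⟩ := ((hP₂'.lift (hg₂ a)).2 v).2 ((hP₂'.2 v).1 h)
            exact ⟨(), t'', (hlift₂.2 _ _).1 ht'', hv.symm⟩
      · constructor
        · rintro ⟨_, _, ⟨rfl, rfl⟩, h⟩
          exact h
        · exact fun h => ⟨_, _, ⟨rfl, rfl⟩, h⟩
    · simp only [← BitTape.head?_word]
      constructor
      · rintro ⟨_, t', ⟨hX, -⟩, hV⟩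
        exact ⟨_, (hP.2 _).1 ⟨_, hX, rfl⟩, hV⟩
      · rintro ⟨w, hw, hV⟩
        obtain ⟨t', ht', h⟩ := ((hP.lift hg₁).2 w).2 hw
        refine ⟨(), t', (hlift.2 _ _).1 ht', ?_⟩
        rwa [h]
  refine (Prog.copy_bind_outputs (hb false) (.inl rfl) (fun k hk => e1 k (hne k hk))
    (ℓ := x.length) (by rw [e0]) key).mono ?_ fun _ => Iff.rfl
  simp

/-- Treat the inputs according to their first bit, which is removed. -/
theorem caseHead {S : Option Bool → List Bool → List Bool → Prop} (hS : ∀ a, NPMV (S a)) :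
    NPMV fun x w => S x.head? x.tail w :=
  (id.branch fun a => tail.comp (hS a)).congr fun x w => by simp

end NPMV

namespace Machine

variable {ι : Type}

theorem steps_iff_chain {M : Machine ι} {O : ι → Lang} {n : ℕ} {c d : M.Cfg} :
    M.Steps O n c d ↔ StepChain (M.Step O) n c d := by
  constructor
  · intro h
    induction h with
    | refl => exact .refl _
    | tail _ hs ih => exact ih.tail hs
  · intro h
    induction h with
    | refl => exact .refl _
    | tail _ hs ih => exact .tail ih hs

end Machine

/-! ### Programs as machines -/

namespace Prog

variable {K : Type}

/-- A program with one kind of exit as a machine which accepts when it exits. -/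
def toMachine (P : Prog K Unit) [Finite K] (i o : K) : Machine Empty where
  K := K
  Q := P.Q
  finite_tapes := inferInstance
  finite_states := P.finite_states
  inTape := i
  outTape := o
  qTape := Empty.elim
  start := P.start
  instr q :=
    match P.code q with
    | .inl _ => .accept
    | .inr δ => .move δ

section toMachine

variable {P : Prog K Unit} [Finite K] {i o : K} {O : Empty → Lang}

theorem toMachine_accept {q : P.Q} :
    (P.toMachine i o).instr q = .accept ↔ P.code q = .inl () := by
  simp only [toMachine]
  cases P.code q <;> simp

theorem toMachine_step {c d : P.Q × Tapes K} :
    (P.toMachine i o).Step O ⟨c.1, c.2⟩ ⟨d.1, d.2⟩ ↔ P.Step c d := by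
  have hmove : ∀ δ, (P.toMachine i o).instr c.1 = .move δ ↔ P.code c.1 = .inr δ := by
    intro δ
    simp only [toMachine]
    cases P.code c.1 with
    | inl => simp
    | inr δ' =>
      constructor
      · intro h
        cases h
        rfl
      · intro h
        cases h
        rfl
  obtain ⟨q, t⟩ := c
  obtain ⟨q', t'⟩ := d
  constructor
  · intro h
    cases h with
    | yes i => exact i.elim
    | no i => exact i.elim
    | move δ _ a h ha => exact ⟨δ, a, (hmove δ).1 h, ha, rfl⟩
  · rintro ⟨δ, a, h, ha, ht⟩
    dsimp at ht
    subst ht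
    exact Machine.Step.move (M := P.toMachine i o) ⟨q, t⟩ δ q' a ((hmove δ).2 h) ha

theorem toMachine_steps {n : ℕ} {c d : P.Q × Tapes K} :
    (P.toMachine i o).Steps O n ⟨c.1, c.2⟩ ⟨d.1, d.2⟩ ↔ StepChain P.Step n c d := by
  rw [Machine.steps_iff_chain]
  constructor
  · exact StepChain.map (fun c : (P.toMachine i o).Cfg => (c.state, c.tape))
      fun a b h => toMachine_step.1 h
  · exact StepChain.map (fun c : P.Q × Tapes K => (⟨c.1, c.2⟩ : (P.toMachine i o).Cfg))
      fun a b h => toMachine_step.2 h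

theorem toMachine_acceptsWith {x w : List Bool} :
    (P.toMachine i o).AcceptsWith O x w ↔
      ∃ t', P.Exits (Tapes.input i x) () t' ∧ (t' o).word = w := by
  constructor
  · rintro ⟨⟨q, t'⟩, ⟨n, hn⟩, hq, hw⟩
    exact ⟨t', ⟨n, q, (toMachine_steps (c := (P.start, Tapes.input i x)) (d := (q, t'))).1 hn,
      toMachine_accept.1 hq⟩, hw⟩
  · rintro ⟨t', ⟨n, q, hp, hq⟩, hw⟩
    exact ⟨⟨q, t'⟩, ⟨n, toMachine_steps.2 hp⟩, toMachine_accept.2 hq, hw⟩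

end toMachine

/-! ### Machines as programs -/

variable {ι : Type}

/-- Run the oracle machine `M` with the constant answers `σ i`. If `σ i = none`, exit with label
`none` instead of querying oracle `i`. The other labels are `some true` (the machine accepts) and
`some false` (it rejects or is stuck). -/
def ofOracle (M : Machine ι) (σ : ι → Option Bool) : Prog M.K (Option Bool) where
  Q := Option M.Q
  finite_states := by
    have := M.finite_states
    infer_instance
  start := some M.start
  code
    | none => .inl (some false)
    | some q =>
      match M.instr q with
      | .accept => .inl (some true)
      | .reject => .inl (some false)
      | .query i y n =>
        match σ i with
        | none => .inl none
        | some b => .inr fun r => {(some (bif b then y else n), Tapes.idle r)}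
      | .move δ => .inr fun r => {p | (δ r = ∅ ∧ p = (none, Tapes.idle r)) ∨
          ∃ q', p.1 = some q' ∧ (q', p.2) ∈ δ r}

/-- The oracles with the constant answers `σ`. -/
def constOracle (σ : ι → Option Bool) : ι → Lang := fun i => {_w | σ i = some true}

section ofOracle

variable {M : Machine ι} {σ : ι → Option Bool}

theorem not_ofOracle_step_none {t : Tapes M.K} {c : Option M.Q × Tapes M.K} :
    ¬ (ofOracle M σ).Step (none, t) c := by
  rintro ⟨δ, a, h, -⟩
  cases h

theorem ofOracle_step_some {q : M.Q} {t : Tapes M.K} {c : Option M.Q × Tapes M.K} :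
    (ofOracle M σ).Step (some q, t) c ↔
      (∃ i y n b, M.instr q = .query i y n ∧ σ i = some b ∧ c = (some (bif b then y else n), t)) ∨
      ∃ δ, M.instr q = .move δ ∧ ((δ t.heads = ∅ ∧ c = (none, t)) ∨
        ∃ q' a, (q', a) ∈ δ t.heads ∧ c = (some q', t.act a)) := by
  obtain ⟨q', t'⟩ := c
  simp only [Step, ofOracle]
  cases h : M.instr q with
  | accept => simp
  | reject => simp
  | query i y n =>
    cases hσ : σ i with
    | none => simp [hσ]
    | some b =>
      simp only [hσ]
      constructor
      · rintro ⟨_, _, hδ, ha, rfl⟩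
        cases hδ
        cases ha
        exact .inl ⟨i, y, n, b, rfl, hσ, by simp⟩
      · rintro (⟨_, _, _, _, hi, hb, hc⟩ | ⟨_, hi, -⟩)
        · cases hi
          rw [hσ] at hb
          cases hb
          cases hc
          exact ⟨_, _, rfl, rfl, by simp⟩
        · cases hi
  | move δ =>
    constructor
    · rintro ⟨_, a, hδ, ha, rfl⟩
      cases hδ
      rcases ha with ⟨he, ha⟩ | ⟨q'', rfl, ha⟩
      · cases ha
        exact .inr ⟨δ, rfl, .inl ⟨he, by simp⟩⟩
      · exact .inr ⟨δ, rfl, .inr ⟨q'', a, ha, rfl⟩⟩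
    · rintro (⟨_, _, _, _, hi, -⟩ | ⟨_, hi, ⟨he, hc⟩ | ⟨q'', a, ha, hc⟩⟩)
      · cases hi
      · cases hi
        cases hc
        exact ⟨_, _, rfl, .inl ⟨he, rfl⟩, by simp⟩
      · cases hi
        cases hc
        exact ⟨_, a, rfl, .inr ⟨q'', rfl, ha⟩, rfl⟩

theorem step_of_ofOracle_step {q q' : M.Q} {t t' : Tapes M.K}
    (h : (ofOracle M σ).Step (some q, t) (some q', t')) :
    M.Step (constOracle σ) ⟨q, t⟩ ⟨q', t'⟩ := by
  rcases ofOracle_step_some.1 h with ⟨i, y, n, b, hi, hb, hc⟩ | ⟨δ, hi, ⟨-, hc⟩ | ⟨_, a, ha, hc⟩⟩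
  · cases hc
    cases b with
    | true => exact .yes ⟨q, t⟩ i y n hi hb
    | false => exact .no ⟨q, t⟩ i y n hi (by simp [constOracle, hb])
  · cases hc
  · cases hc
    exact .move ⟨q, t⟩ δ q' a hi ha

open Classical in
theorem ofOracle_step_of_step {O : ι → Lang} {c d : M.Cfg} (h : M.Step O c d)
    (hσ : ∀ i, M.Asks c i → σ i = some (decide ((c.tape (M.qTape i)).word ∈ O i))) :
    (ofOracle M σ).Step (some c.state, c.tape) (some d.state, d.tape) := by
  refine ofOracle_step_some.2 ?_
  cases h with
  | yes i y n hi hw =>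
    exact .inl ⟨i, y, n, true, hi, by rw [hσ i ⟨y, n, hi⟩, decide_eq_true hw], rfl⟩
  | no i y n hi hw =>
    exact .inl ⟨i, y, n, false, hi, by rw [hσ i ⟨y, n, hi⟩, decide_eq_false hw], rfl⟩
  | move δ q a hi ha => exact .inr ⟨δ, hi, .inr ⟨q, a, ha, rfl⟩⟩

theorem steps_of_ofOracle_chain {n : ℕ} {q q' : M.Q} {t t' : Tapes M.K}
    (h : StepChain (ofOracle M σ).Step n (some q, t) (some q', t')) :
    M.Steps (constOracle σ) n ⟨q, t⟩ ⟨q', t'⟩ := by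
  induction n generalizing q' t' with
  | zero =>
    cases h
    exact .refl _
  | succ n ih =>
    cases h with
    | @tail _ _ b _ h hs =>
      obtain ⟨_ | q₁, t₁⟩ := b
      · exact (not_ofOracle_step_none hs).elim
      · exact .tail (ih h) (step_of_ofOracle_step hs)

/-- The time bound of a machine holds for all oracles, hence for constant ones. The extra step is
the move of a stuck machine into the rejecting state `none`. -/
theorem ofOracle_bounded {x : List Bool} {T : ℕ}
    (hT : ∀ n c, M.Steps (constOracle σ) n (M.init x) c → n ≤ T) :
    (ofOracle M σ).Bounded (Tapes.input M.inTape x) (T + 1) := by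
  rintro n ⟨_ | q, t⟩ h
  · cases h with
    | @tail n _ b _ h hs =>
      obtain ⟨_ | q₁, t₁⟩ := b
      · exact (not_ofOracle_step_none hs).elim
      · exact Nat.succ_le_succ (hT _ _ (steps_of_ofOracle_chain h))
  · exact (hT _ _ (steps_of_ofOracle_chain h)).trans (Nat.le_succ T)

theorem ofOracle_code_true {q : Option M.Q} :
    (ofOracle M σ).code q = .inl (some true) ↔ ∃ q', q = some q' ∧ M.instr q' = .accept := by
  cases q with
  | none => simp [ofOracle]
  | some q =>
    simp only [ofOracle]
    cases h : M.instr q with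
    | query i y n => cases hσ : σ i <;> simp [h, hσ]
    | _ => simp [h]

theorem ofOracle_code_none {q : Option M.Q} :
    (ofOracle M σ).code q = .inl none ↔
      ∃ q' i y n, q = some q' ∧ M.instr q' = .query i y n ∧ σ i = none := by
  cases q with
  | none => simp [ofOracle]
  | some q =>
    simp only [ofOracle]
    cases h : M.instr q with
    | query i y n => cases hσ : σ i <;> simp [h, hσ]
    | _ => simp [h]

/-- A program obtained from an oracle machine can get stuck only in an exit. -/
theorem ofOracle_exits_of_terminal {c : Option M.Q × Tapes M.K}
    (hc : ∀ d, ¬ (ofOracle M σ).Step c d) : ∃ e, (ofOracle M σ).code c.1 = .inl e := by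
  obtain ⟨_ | q, t⟩ := c
  · exact ⟨_, rfl⟩
  cases h : M.instr q with
  | accept => exact ⟨some true, by simp [ofOracle, h]⟩
  | reject => exact ⟨some false, by simp [ofOracle, h]⟩
  | query i y n =>
    cases hσ : σ i with
    | none => exact ⟨none, by simp [ofOracle, h, hσ]⟩
    | some b => exact (hc _ (ofOracle_step_some.2 (.inl ⟨i, y, n, b, h, hσ, rfl⟩))).elim
  | move δ =>
    rcases (δ t.heads).eq_empty_or_nonempty with he | ⟨⟨q', a⟩, ha⟩
    · exact (hc _ (ofOracle_step_some.2 (.inr ⟨δ, h, .inl ⟨he, rfl⟩⟩))).elim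
    · exact (hc _ (ofOracle_step_some.2 (.inr ⟨δ, h, .inr ⟨q', a, ha, rfl⟩⟩))).elim

theorem ofOracle_step_unique (hM : M.Deterministic) (c d d' : Option M.Q × Tapes M.K)
    (h : (ofOracle M σ).Step c d) (h' : (ofOracle M σ).Step c d') : d = d' := by
  obtain ⟨_ | q, t⟩ := c
  · exact (not_ofOracle_step_none h).elim
  rcases ofOracle_step_some.1 h with ⟨i, y, n, b, hi, hb, rfl⟩ | ⟨δ, hi, h⟩ <;>
  rcases ofOracle_step_some.1 h' with ⟨i', y', n', b', hi', hb', rfl⟩ | ⟨δ', hi', h'⟩ <;>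
  rw [hi] at hi' <;> cases hi'
  · rw [hb] at hb'
    cases hb'
    rfl
  · rcases h with ⟨he, rfl⟩ | ⟨q', a, ha, rfl⟩ <;> rcases h' with ⟨he', rfl⟩ | ⟨q'', a', ha', rfl⟩
    · rfl
    · simp [he] at ha'
    · simp [he'] at ha
    · cases hM _ _ hi _ ha ha'
      rfl

theorem not_step_of_code {K E : Type} {P : Prog K E} {q : P.Q} {e : E} (h : P.code q = .inl e)
    (t : Tapes K) (d : P.Q × Tapes K) : ¬ P.Step (q, t) d := by
  rintro ⟨δ, a, h', -⟩
  rw [h] at h'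
  cases h'

/-- A deterministic polynomial-time machine with constant oracles has exactly one result. -/
theorem ofOracle_existsUnique (hM : M.Deterministic) (hp : M.PolyTime) (σ : ι → Option Bool) :
    ∃ g : List Bool → Option Bool × Tapes M.K, ∀ x e t',
      (ofOracle M σ).Exits (Tapes.input M.inTape x) e t' ↔ (e, t') = g x := by
  obtain ⟨p, hp⟩ := hp
  have : ∀ x, ∃ g : Option Bool × Tapes M.K, ∀ e t',
      (ofOracle M σ).Exits (Tapes.input M.inTape x) e t' ↔ (e, t') = g := by
    intro x
    obtain ⟨n, ⟨q, t⟩, hn, hb⟩ := StepChain.exists_terminal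
      (ofOracle_bounded (hp (constOracle σ) x))
    obtain ⟨e, he⟩ := ofOracle_exits_of_terminal hb
    refine ⟨(e, t), fun e' t' => ⟨?_, ?_⟩⟩
    · rintro ⟨n', q', hn', hq'⟩
      have := StepChain.terminal_unique (ofOracle_step_unique hM) hn hn' hb (not_step_of_code hq' t')
      cases this
      rw [he] at hq'
      cases hq'
      rfl
    · intro h
      cases h
      exact ⟨n, q, hn, he⟩
  choose g hg using this
  exact ⟨g, hg⟩

end ofOracle

end Prog

/-! ### Characterization of the classes -/

/-- The prepended bit is the verdict and the rest is the word on tape `k`. Reading the first bit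
gives the result of the run, and dropping it gives the query at which the run was stopped. -/
theorem npmv_of_oracle {ι : Type} {M : Machine ι} (hp : M.PolyTime) {σ : ι → Option Bool}
    {g : List Bool → Option Bool × Tapes M.K}
    (hg : ∀ x e t', (Prog.ofOracle M σ).Exits (Tapes.input M.inTape x) e t' ↔ (e, t') = g x)
    (k : M.K) : NPMV fun x w => w = decide ((g x).1 = some true) :: ((g x).2 k).word := by
  have := M.finite_tapes
  obtain ⟨p, hp⟩ := hp
  refine ⟨M.K, inferInstance,
    (Prog.ofOracle M σ).bind fun e => Prog.prepend k {decide (e = some true)}, M.inTape, k,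
    p + 6, fun x => ?_⟩
  refine ((Prog.ofOracle_bounded (hp (Prog.constOracle σ) x)).spec.bind_outputs
    fun e t' _ => Prog.prepend_outputs k _ t').mono ?_ fun v => ?_
  · simp
  · simp only [hg]
    constructor
    · rintro ⟨e, t', he, _, rfl, rfl⟩
      rw [← he]
    · rintro rfl
      exact ⟨_, _, rfl, _, rfl, rfl⟩

/-- Every exit of a program counts as accepting, so the rejecting and the stuck paths are led into
`Prog.fail`. -/
theorem Machine.PolyTime.npmv {N : Machine Empty} (hp : N.PolyTime) :
    NPMV fun x w => N.AcceptsWith noOracle x w := by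
  classical
  have := N.finite_tapes
  obtain ⟨p, hp⟩ := hp
  let σ : Empty → Option Bool := Empty.elim
  have hO : ∀ O O' : Empty → Lang, O = O' := fun O O' => funext fun i => i.elim
  refine ⟨N.K, inferInstance,
    (Prog.ofOracle N σ).bind fun e => if e = some true then Prog.exit fun _ => () else Prog.fail,
    N.inTape, N.outTape, p + 3, fun x => ?_⟩
  refine ((Prog.ofOracle_bounded (hp (Prog.constOracle σ) x)).spec.bind_outputs
    (V := fun e t' v => e = some true ∧ (t' N.outTape).word = v) (T₂ := 1)
    fun e t' _ => ?_).mono ?_ fun v => ?_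
  · by_cases he : e = some true
    · rw [if_pos he]
      exact ((Prog.exit_spec _ _).outputs _).mono le_rfl fun v => by simp [he]
    · rw [if_neg he]
      exact ((Prog.fail_spec _).outputs _).mono (Nat.zero_le _) fun v => by simp [he]
  · simp
    omega
  · constructor
    · rintro ⟨_, t', ⟨n, q, hn, hq⟩, rfl, rfl⟩
      obtain ⟨q, rfl, hacc⟩ := Prog.ofOracle_code_true.1 hq
      refine ⟨⟨q, t'⟩, ⟨n, ?_⟩, hacc, rfl⟩
      rw [hO noOracle (Prog.constOracle σ)]
      exact Prog.steps_of_ofOracle_chain hn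
    · rintro ⟨c, ⟨n, hn⟩, hc, rfl⟩
      refine ⟨_, c.tape, ⟨n, some c.state, ?_, Prog.ofOracle_code_true.2 ⟨_, rfl, hc⟩⟩, rfl, rfl⟩
      exact (Machine.steps_iff_chain.1 hn).map
        (fun c : N.Cfg => ((some c.state, c.tape) : Option N.Q × Tapes N.K))
        fun a b h => Prog.ofOracle_step_of_step h fun i => i.elim

theorem NPMV.exists_machine {R : List Bool → List Bool → Prop} (h : NPMV R) :
    ∃ N : Machine Empty, N.PolyTime ∧ ∀ x w, N.AcceptsWith noOracle x w ↔ R x w := by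
  obtain ⟨K, _, P, i, o, p, hP⟩ := h
  refine ⟨P.toMachine i o, ⟨p, fun O x n c hc => ?_⟩, fun x w => ?_⟩
  · exact (hP x).1 n (c.state, c.tape) (Prog.toMachine_steps.1 hc)
  · rw [Prog.toMachine_acceptsWith, (hP x).2]

/-- NP languages are the domains of multivalued functions: acceptance means that there is some
output, whatever it is. -/
theorem mem_NP_iff {L : Lang} : L ∈ NP ↔ ∃ R, NPMV R ∧ ∀ x, x ∈ L ↔ ∃ w, R x w := by
  constructor
  · rintro ⟨N, hN, rfl⟩
    refine ⟨_, hN.npmv, fun x => ?_⟩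
    constructor
    · rintro ⟨c, h, hc⟩
      exact ⟨_, c, h, hc, rfl⟩
    · rintro ⟨w, c, h, hc, -⟩
      exact ⟨c, h, hc⟩
  · rintro ⟨R, hR, hL⟩
    obtain ⟨N, hN, h⟩ := hR.exists_machine
    refine ⟨N, hN, Set.ext fun x => (hL x).trans ?_⟩
    simp only [← h]
    constructor
    · rintro ⟨w, c, h, hc, -⟩
      exact ⟨c, h, hc⟩
    · rintro ⟨c, h, hc⟩
      exact ⟨_, c, h, hc, rfl⟩

theorem mem_NPSVt_iff {f : List Bool → List Bool} :
    f ∈ NPSVt ↔ NPMV fun x w => w = f x := by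
  constructor
  · rintro ⟨N, hN, h⟩
    refine hN.npmv.congr fun x w => ⟨(h x).2 w, ?_⟩
    rintro rfl
    exact (h x).1
  · intro hf
    obtain ⟨N, hN, h⟩ := hf.exists_machine
    exact ⟨N, hN, fun x => ⟨(h x _).2 rfl, fun w => (h x w).1⟩⟩

/-! ### A machine with two queries -/

/-- The states of `twoQuery`. -/
inductive TwoQueryState : Type
  | start
  | shift (b : Bool)
  | write (b : Bool)
  | ask
  | halt (b : Bool)

namespace TwoQueryState

theorem finite : Finite TwoQueryState :=
  Finite.of_surjective (fun p : Fin 5 × Bool =>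
    (![start, shift p.2, write p.2, ask, halt p.2] : Fin 5 → TwoQueryState) p.1) fun
    | start => ⟨(0, true), rfl⟩
    | shift b => ⟨(1, b), rfl⟩
    | write b => ⟨(2, b), rfl⟩
    | ask => ⟨(3, true), rfl⟩
    | halt b => ⟨(4, b), rfl⟩

end TwoQueryState

/-- The machine that queries its input `x` to the first oracle, prepends the answer to `x`, queries
the resulting word to the second oracle and accepts if the answer is yes. -/
def twoQuery : Machine (Fin 2) where
  K := Unit
  Q := TwoQueryState
  finite_tapes := inferInstance
  finite_states := TwoQueryState.finite
  inTape := ()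
  outTape := ()
  qTape _ := ()
  start := .start
  instr
    | .start => .query 0 (.shift true) (.shift false)
    | .shift b => .move fun r => {(.write b, fun k => (r k, some .left))}
    | .write b => .move fun _ => {(.ask, fun _ => (some b, none))}
    | .ask => .query 1 (.halt true) (.halt false)
    | .halt true => .accept
    | .halt false => .reject

namespace twoQuery

variable {O : Fin 2 → Lang} {x : List Bool}

open Classical in
/-- The configuration after `n` steps. -/
noncomputable def conf (O : Fin 2 → Lang) (x : List Bool) : ℕ → twoQuery.Cfg
  | 0 => ⟨.start, Tapes.input () x⟩
  | 1 => ⟨.shift (decide (x ∈ O 0)), Tapes.input () x⟩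
  | 2 => ⟨.write (decide (x ∈ O 0)), fun _ => (BitTape.ofWord x).move .left⟩
  | 3 => ⟨.ask, fun _ => ((BitTape.ofWord x).move .left).write (some (decide (x ∈ O 0)))⟩
  | _ => ⟨.halt (decide ((decide (x ∈ O 0) :: x) ∈ O 1)),
      fun _ => ((BitTape.ofWord x).move .left).write (some (decide (x ∈ O 0)))⟩

open Classical in
theorem word_conf_three (k : Unit) :
    ((conf O x 3).tape k).word = decide (x ∈ O 0) :: x := by
  refine (BitTape.word_write_move_left (BitTape.ofWord x) _).trans ?_
  rw [BitTape.word_ofWord]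

theorem word_conf_zero : ((conf O x 0).tape ()).word = x := by
  show (Tapes.input () x ()).word = x
  rw [NPMV.input_unit, BitTape.word_ofWord]

theorem step_query {c d : twoQuery.Cfg} {i : Fin 2} {y n q : TwoQueryState} {w : List Bool}
    {b : Bool} (h : twoQuery.instr c.state = .query i y n) (hw : (c.tape ()).word = w)
    (hb : b = true ↔ w ∈ O i)
    (hq : (bif b then y else n) = q) : twoQuery.Step O c d ↔ d = ⟨q, c.tape⟩ := by
  subst hw hq
  constructor
  · intro hs
    cases hs with
    | yes i' y' n' h' hw =>
      rw [h] at h'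
      cases h'
      rw [hb.2 hw]
      rfl
    | no i' y' n' h' hw =>
      rw [h] at h'
      cases h'
      cases b with
      | true => exact absurd (hb.1 rfl) hw
      | false => rfl
    | move _ _ _ h' => rw [h] at h'; cases h'
  · rintro rfl
    cases b with
    | true => exact .yes c i y n h (hb.1 rfl)
    | false => exact .no c i y n h fun h => by simpa using hb.2 h

theorem step_move {c d : twoQuery.Cfg} {q : TwoQueryState}
    {δ : (Unit → Option Bool) → Set (TwoQueryState × (Unit → TapeAct))} {a : Unit → TapeAct}
    (h : twoQuery.instr c.state = .move δ) (ha : δ (fun k => (c.tape k).head) = {(q, a)}) :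
    twoQuery.Step O c d ↔ d = ⟨q, fun k => (c.tape k).act (a k)⟩ := by
  constructor
  · intro hs
    cases hs with
    | yes _ _ _ h' => rw [h] at h'; cases h'
    | no _ _ _ h' => rw [h] at h'; cases h'
    | move δ' q' a' h' ha' =>
      rw [h] at h'
      cases h'
      have := ha.subset ha'
      cases this
      rfl
  · rintro rfl
    exact .move c δ q a h (ha.symm.subset rfl)

theorem step_conf (n : ℕ) (hn : n < 4) (d : twoQuery.Cfg) :
    twoQuery.Step O (conf O x n) d ↔ d = conf O x (n + 1) := by
  classical
  match n, hn with
  | 0, _ =>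
    have : ∀ b, (bif b then .shift true else .shift false : TwoQueryState) = .shift b := by
      rintro (_ | _) <;> rfl
    rw [step_query (b := decide (x ∈ O 0)) rfl word_conf_zero (by simp) (this _)]
    rfl
  | 1, _ =>
    rw [step_move rfl rfl]
    have : (fun k => ((conf O x 1).tape k).act (((conf O x 1).tape k).head, some .left)) =
        (conf O x 2).tape := funext fun k => by
      rw [BitTape.act_idle_move]
      exact congrArg _ (NPMV.input_unit x)
    rw [show conf O x (1 + 1) = ⟨.write (decide (x ∈ O 0)), (conf O x 2).tape⟩ from rfl, ← this]
  | 2, _ =>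
    rw [step_move rfl rfl]
    rfl
  | 3, _ =>
    have : ∀ b, (bif b then .halt true else .halt false : TwoQueryState) = .halt b := by
      rintro (_ | _) <;> rfl
    rw [step_query (b := decide ((decide (x ∈ O 0) :: x) ∈ O 1)) rfl (word_conf_three _) (by simp)
      (this _)]
    rfl

theorem not_step_conf_four (d : twoQuery.Cfg) : ¬ twoQuery.Step O (conf O x 4) d := by
  intro h
  have : ∀ b, (twoQuery.instr (.halt b) = .accept ∨ twoQuery.instr (.halt b) = .reject) := by
    rintro (_ | _)
    · exact .inr rfl
    · exact .inl rfl
  have hi : twoQuery.instr (conf O x 4).state = .accept ∨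
    twoQuery.instr (conf O x 4).state = .reject := this _
  cases h <;> simp_all

/-- The run is forced and ends after four steps; time bound, order of queries and verdict are all
read off from `conf`. -/
theorem steps_iff {n : ℕ} {c : twoQuery.Cfg} :
    twoQuery.Steps O n (twoQuery.init x) c ↔ n ≤ 4 ∧ c = conf O x n := by
  constructor
  · intro h
    generalize hi : twoQuery.init x = c₀ at h
    induction h with
    | refl => exact ⟨Nat.zero_le _, hi.symm⟩
    | @tail n _ _ _ _ hs ih =>
      obtain ⟨hn, rfl⟩ := ih hi
      rcases hn.lt_or_eq with hn | rfl
      · exact ⟨hn, (step_conf n hn _).1 hs⟩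
      · exact (not_step_conf_four _ hs).elim
  · rintro ⟨hn, rfl⟩
    induction n with
    | zero => exact .refl _
    | succ n ih => exact .tail (ih (by omega)) ((step_conf n hn _).2 rfl)

theorem occurs_iff {c : twoQuery.Cfg} :
    twoQuery.Occurs O x c ↔ ∃ n ≤ 4, c = conf O x n := by
  simp only [Machine.Occurs, steps_iff]

theorem asks_conf {n : ℕ} (hn : n ≤ 4) {i : Fin 2} (h : twoQuery.Asks (conf O x n) i) :
    (n = 0 ∧ i = 0) ∨ (n = 3 ∧ i = 1) := by
  obtain ⟨y, m, h⟩ := h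
  match n, hn with
  | 0, _ => cases h; exact .inl ⟨rfl, rfl⟩
  | 1, _ => cases h
  | 2, _ => cases h
  | 3, _ => cases h; exact .inr ⟨rfl, rfl⟩
  | 4, _ =>
    have : ∀ b, twoQuery.instr (.halt b) ≠ .query i y m := by
      rintro (_ | _) <;> intro h <;> cases h
    exact (this _ h).elim

open Classical in
theorem decidesWith {A B L : Lang} (h : ∀ x, x ∈ L ↔ (decide (x ∈ A) :: x) ∈ B) :
    DecidesWith twoQuery A B L := by
  refine ⟨?_, ⟨4, fun O x n c hs => by simpa using (steps_iff.1 hs).1⟩, ?_, ?_⟩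
  · rintro (_ | b | b | _ | (_ | _)) δ hδ r <;> cases hδ <;> exact Set.subsingleton_singleton
  · rintro x c d n i j ⟨m, hm⟩ hi hs hj
    have hd := steps_iff.1 (Machine.steps_iff_chain.2
      ((Machine.steps_iff_chain.1 hm).trans (Machine.steps_iff_chain.1 hs)))
    obtain ⟨hm', rfl⟩ := steps_iff.1 hm
    obtain ⟨hn, rfl⟩ := hd
    rcases asks_conf hm' hi with ⟨rfl, rfl⟩ | ⟨rfl, rfl⟩ <;>
    rcases asks_conf hn hj with ⟨h1, rfl⟩ | ⟨h1, rfl⟩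
    · omega
    · exact Nat.zero_lt_one
    · omega
    · omega
  · ext x
    rw [h]
    have key : ∀ b, twoQuery.instr (.halt b) = .accept ↔ b = true := by
      rintro (_ | _)
      · exact ⟨(fun h => by cases h), (fun h => by cases h)⟩
      · exact ⟨fun _ => rfl, fun _ => rfl⟩
    constructor
    · intro hx
      exact ⟨_, occurs_iff.2 ⟨4, le_rfl, rfl⟩, (key _).2 (decide_eq_true hx)⟩
    · rintro ⟨c, hc, ha⟩
      obtain ⟨n, hn, rfl⟩ := occurs_iff.1 hc
      match n, hn with
      | 0, _ => cases ha
      | 1, _ => cases ha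
      | 2, _ => cases ha
      | 3, _ => cases ha
      | 4, _ => exact of_decide_eq_true ((key _).1 ha)

open Classical in
theorem word_of_asks {c : twoQuery.Cfg} (hc : twoQuery.Occurs O x c) (ha : twoQuery.Asks c 1) :
    (c.tape (twoQuery.qTape 1)).word = decide (x ∈ O 0) :: x := by
  obtain ⟨n, hn, rfl⟩ := occurs_iff.1 hc
  rcases asks_conf hn ha with ⟨-, h⟩ | ⟨rfl, -⟩
  · cases h
  · exact word_conf_three _

end twoQuery

/-! ### Closure properties -/

namespace NPMV

variable {R S : List Bool → List Bool → Prop}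

/-- The condition does not depend on the input, so the program can be chosen according to its truth
value. -/
theorem and_const (hR : NPMV R) (p : Prop) : NPMV fun x w => p ∧ R x w := by
  by_cases hp : p
  · exact hR.congr fun x w => by simp [hp]
  · exact empty.congr fun x w => by simp [hp]

theorem ite_const (hR : NPMV R) (hS : NPMV S) (p : Prop) [Decidable p] :
    NPMV (if p then R else S) := by
  split_ifs
  · exact hR
  · exact hS

/-- Treat `f x` according to its first two bits. -/
theorem of_table {α : List Bool → Bool → Bool} {z : List Bool → List Bool}
    (hf : NPMV fun x w => w = α x false :: α x true :: z x)
    {S : Bool → Bool → List Bool → List Bool → Prop} (hS : ∀ a b, NPMV (S a b)) :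
    NPMV fun x w => S (α x false) (α x true) (z x) w :=
  (hf.comp (caseHead fun a => caseHead fun b => hS (a.getD false) (b.getD false))).congr
    fun x w => by simp

open Classical in
/-- Prepend the value of the characteristic function of a language in NP ∩ coNP. -/
theorem characteristic {B : Lang} (hB : B ∈ NP) (hB' : B ∈ co NP) :
    NPMV fun y w => w = decide (y ∈ B) :: y := by
  obtain ⟨R, hR, h⟩ := mem_NP_iff.1 hB
  obtain ⟨R', hR', h'⟩ := mem_NP_iff.1 hB'
  -- Guess the bit, verify it with the witness relation of `B` or of `Bᶜ`, and put it back in front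
  -- of `y`. The guessed word is never empty, so the choice made for `none` plays no role.
  refine ((prepend Set.univ).comp (caseHead fun a => (hR.ite_const hR' (a = some true)).branch
    fun _ => cons (a.getD false))).congr fun y w => ?_
  have h1 : ∀ y w, (∃ u, R y u ∧ w = true :: y) ↔ y ∈ B ∧ w = true :: y := by
    simp [h]
  have h2 : ∀ y w, (∃ u, R' y u ∧ w = false :: y) ↔ y ∉ B ∧ w = false :: y := by
    intro y w
    rw [← Set.mem_compl_iff, h', exists_and_right]
  constructor
  · rintro ⟨_, ⟨b, -, rfl⟩, hb⟩
    cases b with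
    | true =>
      obtain ⟨h3, rfl⟩ := (h1 y w).1 (by simpa using hb)
      simp [h3]
    | false =>
      obtain ⟨h3, rfl⟩ := (h2 y w).1 (by simpa using hb)
      simp [h3]
  · rintro rfl
    refine ⟨decide (y ∈ B) :: y, ⟨_, trivial, rfl⟩, ?_⟩
    by_cases hy : y ∈ B
    · simpa [hy] using (h y).1 hy
    · simpa [hy] using (h' y).1 hy

end NPMV

theorem inter_mem_NP {A B : Lang} (hA : A ∈ NP) (hB : B ∈ NP) : A ∩ B ∈ NP := by
  obtain ⟨R, hR, h⟩ := mem_NP_iff.1 hA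
  obtain ⟨S, hS, h'⟩ := mem_NP_iff.1 hB
  exact mem_NP_iff.2 ⟨_, hR.branch fun _ => hS, fun x => by
    rw [Set.mem_inter_iff, h, h']
    exact ⟨fun ⟨⟨w, hw⟩, v, hv⟩ => ⟨v, w, hw, hv⟩, fun ⟨v, w, hw, hv⟩ => ⟨⟨w, hw⟩, v, hv⟩⟩⟩

/-- The words whose first bit tells in which of two languages the rest is. -/
theorem tagged_mem_NP {A B : Lang} (hA : A ∈ NP) (hB : B ∈ NP) :
    {y | ∃ x, (y = true :: x ∧ x ∈ A) ∨ (y = false :: x ∧ x ∈ B)} ∈ NP := by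
  classical
  obtain ⟨R, hR, h⟩ := mem_NP_iff.1 hA
  obtain ⟨S, hS, h'⟩ := mem_NP_iff.1 hB
  refine mem_NP_iff.2 ⟨_, NPMV.caseHead fun a => hR.ite_const
    (hS.ite_const NPMV.empty (a = some false)) (a = some true), fun y => ?_⟩
  rcases y with _ | ⟨_ | _, y⟩ <;> simp [h, h']

/-! ### Reductions and ordered queries -/

/-- A language that is decided from the truth table and the query by an NP machine. -/
theorem table_mem_NP {α : List Bool → Bool → Bool} {z : List Bool → List Bool}
    (hf : NPMV fun x w => w = α x false :: α x true :: z x)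
    {S : Bool → Bool → List Bool → List Bool → Prop} (hS : ∀ a b, NPMV (S a b)) {L : Lang}
    (hL : ∀ x, x ∈ L ↔ ∃ w, S (α x false) (α x true) (z x) w) : L ∈ NP :=
  mem_NP_iff.2 ⟨_, hf.of_table hS, hL⟩

/-- Negating both entries of the truth table keeps the query. This carries the inclusion in DP over
to coDP. -/
theorem compl_mem_RSN {L : Lang} (hL : L ∈ RSN NP) : Lᶜ ∈ RSN NP := by
  obtain ⟨B, hB, z, α, hf, h⟩ := hL
  refine ⟨B, hB, z, fun x b => !α x b, mem_NPSVt_iff.2 ?_, fun x => ?_⟩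
  · exact ((mem_NPSVt_iff.1 hf).of_table (S := fun a b y w => w = (!a) :: (!b) :: y) fun a b =>
      ((NPMV.cons (!b)).comp (NPMV.cons (!a))).congr fun y w => by simp).congr fun x w => Iff.rfl
  · rw [Set.mem_compl_iff, h]
    simp

/-- If `z x ∉ B`, the first set reduces to `α x false` and the second is avoided. If `z x ∈ B`,
removing the second set leaves exactly the condition `α x true`. In both sets `z x ∈ B` occurs only
positively, and the table is computable, so both are in NP. -/
theorem RSN_subset_DP : RSN NP ⊆ DP := by
  rintro L ⟨B, hB, z, α, hf, h⟩
  rw [mem_NPSVt_iff] at hf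
  obtain ⟨R, hR, hBR⟩ := mem_NP_iff.1 hB
  classical
  refine ⟨{x | α x false = true ∨ (α x true = true ∧ z x ∈ B)}, ?_,
    {x | α x true = false ∧ z x ∈ B}, ?_, ?_⟩
  · refine table_mem_NP hf (S := fun a b => if a = true then fun y w => w = y else
      fun y w => b = true ∧ R y w) (fun a b => NPMV.id.ite_const (hR.and_const _) _) fun x => ?_
    cases hx : α x false <;> simp [hx, hBR]
  · refine table_mem_NP hf (S := fun _ b y w => b = false ∧ R y w)
      (fun a b => hR.and_const _) fun x => ?_
    simp [hBR]
  · ext x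
    rw [h, Set.mem_sdiff]
    by_cases hz : z x ∈ B <;> cases h0 : α x false <;> cases h1 : α x true <;> simp [hz, h0, h1]

theorem RSN_subset_DP_inter_co_DP : RSN NP ⊆ DP ∩ co DP :=
  fun _ hL => ⟨RSN_subset_DP hL, RSN_subset_DP (compl_mem_RSN hL)⟩

/-- The first oracle answers "`z x ∈ B`?" on the input `x` itself, and the second evaluates the
truth table at the tagged input. Single-valuedness puts `{x | α x b = c}` in NP for both values of
`c`. -/
theorem RSN_subset_POrdered : RSN NP ⊆ POrdered NP (NP ∩ co NP) := by
  rintro L ⟨B, hB, z, α, hf, h⟩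
  rw [mem_NPSVt_iff] at hf
  obtain ⟨R, hR, hBR⟩ := mem_NP_iff.1 hB
  have key : ∀ c b, {x | α x b = c} ∈ NP := fun c b =>
    table_mem_NP hf (S := fun a a' y w => (bif b then a' else a) = c ∧ w = y)
      (fun _ _ => NPMV.id.and_const _) fun x => by cases b <;> simp
  refine ⟨{x | z x ∈ B}, table_mem_NP hf (S := fun _ _ => R) (fun _ _ => hR) fun x => hBR _,
    {y | ∃ x, (y = true :: x ∧ α x true = true) ∨ (y = false :: x ∧ α x false = true)},
    ⟨tagged_mem_NP (key true true) (key true false), ?_⟩, twoQuery, twoQuery.decidesWith ?_⟩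
  · have hnil := tagged_mem_NP (key false true) (key false false)
    obtain ⟨S, hS, hS'⟩ := mem_NP_iff.1 hnil
    classical
    -- The complement of the second oracle also contains the empty word, which carries no tag; it is
    -- accepted separately.
    refine mem_NP_iff.2 ⟨_, NPMV.id.branch fun a => NPMV.id.ite_const hS (a = none), fun y => ?_⟩
    rcases y with _ | ⟨_ | _, y⟩
    · simp
    · simp [← hS']
    · simp [← hS']
  · intro x
    rw [h]
    by_cases hx : z x ∈ B <;> simp [hx]

/-- On `L₁ ∩ L₃`, membership in `L` means `x ∈ L₄` and non-membership means `x ∈ L₂`. Off `L₁ ∩ L₃`,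
they mean `x ∈ L₁` and `x ∈ L₃`. Either pair is complementary at `x` provided that the tag is the
true answer, which is what the guarded class demands. -/
theorem DP_inter_co_DP_subset_PGuarded : DP ∩ co DP ⊆ PGuarded := by
  rintro L ⟨⟨L₁, h₁, L₂, h₂, hL⟩, L₃, h₃, L₄, h₄, hL'⟩
  have e1 : ∀ x, x ∈ L ↔ x ∈ L₁ ∧ x ∉ L₂ := fun x => by rw [hL]; rfl
  have e2 : ∀ x, x ∉ L ↔ x ∈ L₃ ∧ x ∉ L₄ := fun x => by rw [← Set.mem_compl_iff, hL']; rfl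
  classical
  refine ⟨L₁ ∩ L₃, inter_mem_NP h₁ h₃, _, tagged_mem_NP h₄ h₁, twoQuery,
    twoQuery.decidesWith fun x => ?_, _, tagged_mem_NP h₂ h₃, ?_⟩
  · have := e1 x
    have := e2 x
    by_cases hx : x ∈ L₁ ∩ L₃
    · have := hx.1
      have := hx.2
      simp [hx]
      tauto
    · have : ¬ (x ∈ L₁ ∧ x ∈ L₃) := hx
      simp [hx]
      tauto
  · rintro y ⟨x, c, hc, ha, rfl⟩
    have hw : (c.tape (twoQuery.qTape 1)).word = decide (x ∈ L₁ ∩ L₃) :: x :=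
      (twoQuery.word_of_asks hc ha).trans
        (congrArg (· :: x) (decide_eq_decide.2 Iff.rfl))
    rw [hw]
    have := e1 x
    have := e2 x
    by_cases hx : x ∈ L₁ ∩ L₃
    · have := hx.1
      have := hx.2
      simp [hx]
      tauto
    · have : ¬ (x ∈ L₁ ∧ x ∈ L₃) := hx
      simp [hx]
      tauto

/-! ### From ordered queries to a reduction -/

open Classical in
/-- If `σ` predicts the answers to all queries on the way to `c`, then the machine with the constant
answers `σ` reaches `c`. -/
theorem ofOracle_chain_of_steps {ι : Type} {M : Machine ι} {O : ι → Lang} {σ : ι → Option Bool}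
    {n : ℕ} {c₀ c : M.Cfg} (h : M.Steps O n c₀ c)
    (hσ : ∀ m k d i, M.Steps O m c₀ d → M.Steps O (k + 1) d c → M.Asks d i →
      σ i = some (decide ((d.tape (M.qTape i)).word ∈ O i))) :
    StepChain (Prog.ofOracle M σ).Step n (some c₀.state, c₀.tape) (some c.state, c.tape) := by
  induction h with
  | refl => exact .refl _
  | tail h hs ih =>
    exact (ih fun m k d i hm hk => hσ m (k + 1) d i hm (hk.tail hs)).tail
      (Prog.ofOracle_step_of_step hs fun i hi => hσ _ 0 _ i h (.tail (.refl _) hs) hi)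

open Classical in
theorem POrdered_subset_RSN : POrdered NP (NP ∩ co NP) ⊆ RSN NP := by
  rintro L ⟨A, hA, B, ⟨hB, hB'⟩, M, hdet, hpoly, hord, hL⟩
  set O : Fin 2 → Lang := ![A, B] with hO
  choose g hg using Prog.ofOracle_existsUnique hdet hpoly
  have hn := fun σ k => npmv_of_oracle hpoly (hg σ) k
  -- With `none` the simulation stops at the query. If that query is never asked, the word is
  -- whatever is left on the tape; `hq₀` and `hq₁` below concern only configurations that ask.
  let z : List Bool → List Bool := fun x => ((g ![none, none] x).2 (M.qTape 0)).word
  let y : Bool → List Bool → List Bool := fun a x => ((g ![some a, none] x).2 (M.qTape 1)).word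
  let v : Bool → Bool → List Bool → Bool := fun a c x =>
    decide ((g ![some a, some c] x).1 = some true)
  let α : List Bool → Bool → Bool := fun x a => v a (decide (y a x ∈ B)) x
  have hz : NPMV fun x w => w = z x :=
    ((hn ![none, none] (M.qTape 0)).comp NPMV.tail).congr fun x w => by simp [z]
  have hy : ∀ a, NPMV fun x w => w = y a x := fun a =>
    ((hn ![some a, none] (M.qTape 1)).comp NPMV.tail).congr fun x w => by simp [y]
  -- Outputs that merely begin with `α x a` suffice, since `branch` looks at the first symbol only;
  -- what follows is the content of the output tape of `M`.
  have hα : ∀ a, ∃ R, NPMV R ∧ ∀ x, (∃ w, R x w) ∧ ∀ w, R x w → w.head? = some (α x a) := by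
    intro a
    refine ⟨_, ((hy a).comp (NPMV.characteristic hB hB')).branch fun c =>
      hn ![some a, some (c.getD false)] M.outTape, fun x => ⟨?_, ?_⟩⟩
    · exact ⟨_, _, ⟨_, rfl, rfl⟩, rfl⟩
    · rintro w ⟨_, ⟨_, rfl, rfl⟩, rfl⟩
      rfl
  have hf : NPMV fun x w => w = α x false :: α x true :: z x := by
    obtain ⟨R₀, hR₀, h₀⟩ := hα false
    obtain ⟨R₁, hR₁, h₁⟩ := hα true
    refine (hR₀.branch fun a => hR₁.branch fun b =>
      hz.comp ((NPMV.cons (b.getD false)).comp (NPMV.cons (a.getD false)))).congr fun x w => ?_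
    constructor
    · rintro ⟨u₀, hu₀, u₁, hu₁, _, rfl, _, rfl, rfl⟩
      rw [(h₀ x).2 _ hu₀, (h₁ x).2 _ hu₁]
      rfl
    · rintro rfl
      obtain ⟨⟨u₀, hu₀⟩, h₀⟩ := h₀ x
      obtain ⟨⟨u₁, hu₁⟩, h₁⟩ := h₁ x
      refine ⟨u₀, hu₀, u₁, hu₁, _, rfl, _, rfl, ?_⟩
      rw [h₀ _ hu₀, h₁ _ hu₁]
      rfl
  refine ⟨A, hA, z, α, mem_NPSVt_iff.2 hf, fun x => ?_⟩
  -- the word of the query to the first oracle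
  have hq₀ : ∀ n c, M.Steps O n (M.init x) c → M.Asks c 0 → (c.tape (M.qTape 0)).word = z x := by
    rintro n c hc ⟨s, s', hs⟩
    -- An earlier query would have an index below `0`, so no answer has to be predicted.
    have := ofOracle_chain_of_steps (σ := ![none, none]) hc fun m k d i hm hk hi =>
      absurd (hord x d c k i 0 ⟨m, hm⟩ hi hk ⟨s, s', hs⟩) (Fin.not_lt_zero i)
    have := (hg ![none, none] x none c.tape).1
      ⟨n, some c.state, this, Prog.ofOracle_code_none.2 ⟨_, 0, s, s', rfl, hs, rfl⟩⟩
    show _ = ((g ![none, none] x).2 (M.qTape 0)).word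
    rw [← this]
  set a := decide (z x ∈ A) with ha
  set c₁ := decide (y a x ∈ B) with hc₁
  have hq₁ : ∀ n c, M.Steps O n (M.init x) c → M.Asks c 1 →
      (c.tape (M.qTape 1)).word = y a x := by
    rintro n c hc ⟨s, s', hs⟩
    -- Only oracle `0` can have been asked before, and by `hq₀` its answer is `a`.
    have := ofOracle_chain_of_steps (σ := ![some a, none]) hc fun m k d i hm hk hi => by
      have := hord x d c k i 1 ⟨m, hm⟩ hi hk ⟨s, s', hs⟩
      obtain rfl : i = 0 := Fin.lt_one_iff i |>.1 this
      rw [hq₀ m d hm hi]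
      rfl
    have := (hg ![some a, none] x none c.tape).1
      ⟨n, some c.state, this, Prog.ofOracle_code_none.2 ⟨_, 1, s, s', rfl, hs, rfl⟩⟩
    show _ = ((g ![some a, none] x).2 (M.qTape 1)).word
    rw [← this]
  have hchain : ∀ n c, M.Steps O n (M.init x) c →
      StepChain (Prog.ofOracle M ![some a, some c₁]).Step n (some M.start, (M.init x).tape)
        (some c.state, c.tape) := by
    intro n c hc
    refine ofOracle_chain_of_steps hc fun m k d i hm hk hi => ?_
    have : i = 0 ∨ i = 1 := by fin_cases i <;> simp
    rcases this with rfl | rfl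
    · rw [hq₀ m d hm hi]
      rfl
    · rw [hq₁ m d hm hi]
      rfl
  show x ∈ L ↔ decide ((g ![some a, some c₁] x).1 = some true) = true
  rw [decide_eq_true_iff, hL]
  constructor
  · rintro ⟨c, ⟨n, hn⟩, hc⟩
    rw [← (hg ![some a, some c₁] x (some true) c.tape).1
      ⟨n, _, hchain n c hn, Prog.ofOracle_code_true.2 ⟨_, rfl, hc⟩⟩]
  · intro hv
    obtain ⟨p, hp⟩ := hpoly
    -- The true run reaches a configuration without successor. If it were rejecting or stuck there,
    -- the simulation would also have the exit `some false`, against the uniqueness of its result.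
    obtain ⟨n, c, hn, hterm⟩ := StepChain.exists_terminal
      fun n b hb => hp O x n b (Machine.steps_iff_chain.2 hb)
    have hn := Machine.steps_iff_chain.2 hn
    refine ⟨c, ⟨n, hn⟩, ?_⟩
    have hc := hchain n c hn
    have hno : ¬ ∃ t, (Prog.ofOracle M ![some a, some c₁]).Exits (Tapes.input M.inTape x)
        (some false) t := by
      rintro ⟨t, ht⟩
      rw [← (hg _ x _ t).1 ht] at hv
      cases hv
    cases hi : M.instr c.state with
    | accept => rfl
    | reject => exact (hno ⟨c.tape, n, _, hc, by simp [Prog.ofOracle, hi]⟩).elim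
    | query i s s' =>
      by_cases hw : (c.tape (M.qTape i)).word ∈ O i
      · exact (hterm _ (.yes c i s s' hi hw)).elim
      · exact (hterm _ (.no c i s s' hi hw)).elim
    | move δ =>
      rcases (δ (Tapes.heads c.tape)).eq_empty_or_nonempty with he | ⟨⟨q, b⟩, hb⟩
      · exact (hno ⟨c.tape, _, none, hc.tail
          (Prog.ofOracle_step_some.2 (.inr ⟨δ, hi, .inl ⟨he, rfl⟩⟩)), rfl⟩).elim
      · exact (hterm _ (.move c δ q b hi hb)).elim

theorem theoremt :
    RSN NP = POrdered NP (NP ∩ co NP) ∧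
    POrdered NP (NP ∩ co NP) ⊆ DP ∩ co DP ∧
    DP ∩ co DP ⊆ PGuarded :=
  ⟨RSN_subset_POrdered.antisymm POrdered_subset_RSN,
    fun _ hL => RSN_subset_DP_inter_co_DP (POrdered_subset_RSN hL),
    DP_inter_co_DP_subset_PGuarded⟩
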